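/- Let $\mu,g,L>0$. For $a>0$ let $u_a:[0,\infty)\to\mathbb R$ be the solution of $$u''(\bar s)+\frac{u(\bar s)}{\sqrt{\bar s^2+u(\bar s)^2}}=0,\qquad u(0)=0,\quad u'(0)=a .$$ For bounds $a_{\max},\bar L_{\max}\in(0,\infty]$ let $$\mathcal S=\mathcal S_{a_{\max},\bar L_{\max}}=\{(\bar s,u_a(\bar s),u_a'(\bar s)) : 0<a<a_{\max},\ 0<\bar s<\bar L_{\max}\}\subset\mathbb R^3 .$$ A (non-trivial) configuration of the rotating chain of length $L$ and linear density $\mu$ is a pair $(\omega,\rho)$ with $\omega>0$ and $\rho:[0,L]\to\mathbb R$ differentiable, $|\rho'|<1$, $\rho(0)>0$ and $$\frac{d}{ds}\Big(\frac{\mu g s}{\sqrt{1-\rho'^2}}\,\rho'\Big)+\mu\rho\,\omega^2=0\quad\text{on }[0,L].$$ Its attachment radius is $r=\rho(L)$; it is in rotation mode $k$ if $\rho$ has exactly $k$ zeros in $(0,L)$; and it is represented by the point $$\Big(\frac{L\omega^2}{g},\ -\frac{\rho'(L)}{\sqrt{1-\rho'(L)^2}}\cdot\frac{L\omega^2}{g},\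 \frac{\rho(L)\,\omega^2}{g}\Big),$$ which is $(\bar L,u_a(\bar L),u_a'(\bar L))$ with $\bar L=L\omega^2/g$ and $a=\rho(0)\omega^2/g$. For $i\ge 1$, the $i$-th zero-radius locus on $\mathcal S$ is the set of points of $\mathcal S$ that represent configurations with $r=0$ for which $s=L$ is the $i$-th zero of $\rho$ in $(0,L]$. Let $i\ge1$. The Bessel function $J_0$ has an $i$-th positive zero $h_i$. Put $\omega_i=\frac{h_i}{2}\sqrt{g/L}$ and $\bar L_i=L\omega_i^2/g$. Then: (i) If $\bar L_i<\bar L_{\max}$, the $i$-th zero-radius locus is a curve that branches out from the $\bar s$-axis at $(\bar L_i,0,0)$: there is a topological embedding $\gamma:[0,\infty)\to\mathbb R^3$ with $\gamma(0)=(\bar L_i,0,0)$ such that $\gamma((0,\infty))$ is the locus and does not meet the $\bar s$-axis; moreover, for all real $a<a_{\max}$ and $l<\bar L_{\max}$, $\gamma(t)\notin\mathcal S_{a,l}$ for all large $t$. If $a_{\max}=\bar L_{\max}=\infty$, the curve is infinite: $\|\gamma(t)\|\to\infty$ as $t\to\infty$. (ii) The $i$-th zero-radius locus separates, on $\mathcal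 S$, the configurations in rotation mode $i-1$ from those in rotation mode $i$: every connected subset of $\mathcal S$ (in particular every path in $\mathcal S$) that contains a point representing a configuration in mode $i-1$ and a point representing a configuration in mode $i$ meets the $i$-th zero-radius locus. -/

import Mathlib

namespace RotatingChain

open Set

/-- `z` is the `i`-th positive zero of `f` (counted from `i = 1`): `f z = 0`, and `f` has exactly
`i - 1` zeros in the open interval `(0, z)`. -/
def IsNthZero (f : ℝ → ℝ) (i : ℕ) (z : ℝ) : Prop :=
  0 < z ∧ f z = 0 ∧ {x ∈ Ioo 0 z | f x = 0}.encard + 1 = (i : ℕ∞)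

/-- The Bessel function `J₀`, by its power series. -/
noncomputable def besselJ0 (x : ℝ) : ℝ :=
  ∑' k : ℕ, (-1) ^ k / ((k.factorial : ℝ) ^ 2) * (x / 2) ^ (2 * k)

/-- The discrete angular speed `(h / 2) √(g / L)` attached to a zero `h` of `J₀`. -/
noncomputable def discreteSpeed (g L h : ℝ) : ℝ := h / 2 * √(g / L)

/-- The dimensionless length `L ω² / g`. -/
noncomputable def dimlessLength (g L ω : ℝ) : ℝ := L * ω ^ 2 / g

/-- `u` (with derivative `v = u'`) solves the dimensionless shape equation
`u'' + u / √(s² + u²) = 0` on `[0, ∞)` with `u 0 = 0` and `u' 0 = a`. At the singular point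
`s = 0` the second-order equation is replaced by continuity of `u'`. -/
structure IsShot (a : ℝ) (u v : ℝ → ℝ) : Prop where
  u_zero : u 0 = 0
  v_zero : v 0 = a
  deriv_u : ∀ s, 0 ≤ s → HasDerivWithinAt u (v s) (Ici 0) s
  cont_v : ContinuousOn v (Ici 0)
  deriv_v : ∀ s, 0 < s → HasDerivAt v (-(u s / √(s ^ 2 + u s ^ 2))) s

/-- The surface `𝒮`: the union over `0 < a < aMax` of the curves `(s, u_a s, u_a' s)`,
`0 < s < LMax`. The bounds may be finite or infinite. -/
def surface (aMax LMax : EReal) : Set (ℝ × ℝ × ℝ) :=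
  {p | ∃ (a s : ℝ) (u v : ℝ → ℝ), 0 < a ∧ (a : EReal) < aMax ∧ 0 < s ∧ (s : EReal) < LMax ∧
    IsShot a u v ∧ p = (s, u s, v s)}

/-- The slope `ρ'` of a shape function on `[0, L]` (one-sided at the two ends). -/
noncomputable def slope (L : ℝ) (ρ : ℝ → ℝ) (s : ℝ) : ℝ := derivWithin ρ (Icc 0 L) s

/-- `(ω, ρ)` is a non-trivial configuration of the chain of length `L` and linear density `μ`:
`(μ g s ρ' / √(1 - ρ'²))' + μ ρ ω² = 0` on `[0, L]`, with `ω > 0` and `ρ 0 > 0`; here `s = 0` is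
the free end and `s = L` the attached end. The attachment radius is `ρ L`. -/
structure IsConfiguration (μ g L ω : ℝ) (ρ : ℝ → ℝ) : Prop where
  speed_pos : 0 < ω
  free_end_pos : 0 < ρ 0
  differentiable : DifferentiableOn ℝ ρ (Icc 0 L)
  slope_lt : ∀ s ∈ Icc 0 L, |slope L ρ s| < 1
  equation : ∀ s ∈ Icc 0 L,
    HasDerivWithinAt (fun t => μ * g * t / √(1 - slope L ρ t ^ 2) * slope L ρ t)
      (-(μ * ρ s * ω ^ 2)) (Icc 0 L) s

/-- The point of `ℝ³` that represents a configuration, `(L̄, u L̄, u' L̄)` with `L̄ = L ω² / g`.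
In the variable `U = ρ' / √(1 - ρ'²) · s ω² / g` one has `U' = -ρ ω² / g`, so `U' 0 < 0`; as `U` and
`-U` describe the same configuration, the representative `u = -U`, with `u' 0 > 0`, is taken. -/
noncomputable def endpoint (g L ω : ℝ) (ρ : ℝ → ℝ) : ℝ × ℝ × ℝ :=
  (dimlessLength g L ω,
    -(slope L ρ L / √(1 - slope L ρ L ^ 2) * (L * ω ^ 2 / g)),
    ρ L * ω ^ 2 / g)

/-- The `i`-th zero-radius locus on the surface: the points representing configurations with
attachment radius `ρ L = 0` for which the attached end is the `i`-th zero of the shape function. -/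
def zeroRadiusLocus (μ g L : ℝ) (aMax LMax : EReal) (i : ℕ) : Set (ℝ × ℝ × ℝ) :=
  {p ∈ surface aMax LMax | ∃ (ω : ℝ) (ρ : ℝ → ℝ), IsConfiguration μ g L ω ρ ∧
    endpoint g L ω ρ = p ∧ IsNthZero ρ i L}

/-- The points of the surface representing configurations in rotation mode `i`: the shape function
has exactly `i` zeros strictly between the two ends of the chain. -/
def rotationMode (μ g L : ℝ) (aMax LMax : EReal) (i : ℕ) : Set (ℝ × ℝ × ℝ) :=
  {p ∈ surface aMax LMax | ∃ (ω : ℝ) (ρ : ℝ → ℝ), IsConfiguration μ g L ω ρ ∧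
    endpoint g L ω ρ = p ∧ {s ∈ Ioo 0 L | ρ s = 0}.encard = (i : ℕ∞)}

end RotatingChain

/-! Put v = u', so that u(s) = s · avg v(s). The force u/√(s² + u²) then equals `pull 1` of that
average, a bounded 1-Lipschitz function, and the equation, singular at s = 0, becomes the regular
Volterra equation v(s) = a - ∫₀ˢ pull 1 (avg v). Dividing by a gives the profile `prof a`, which
still makes sense at a = 0. There the equation is linear and its Picard iterates are the partial
sums of a Bessel series: prof 0 (x²/4) = J₀(x).

The vector (`prof`, `prim`) never vanishes and turns strictly in one direction, and it turns for
ever because a solution cannot keep v of one sign (`not_forall_pos`). Hence the zeros of `prof a`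
form a sequence `tau n a`, reached at the angles (n + 1/2)π and continuous in a. In dimensionless
variables a configuration is a shot read backwards from its attached end, with ρ proportional to v.
So the (n+1)-th locus is the graph s = tau n a over a > 0, and its limit at a = 0 is s = h²/4 with h
the (n+1)-th zero of J₀.

Separation needs no more than this. A point of the surface determines a, by backward uniqueness, and
does so continuously; s - tau n a is therefore continuous on the surface, nonpositive in mode n and
positive in mode n + 1.

The curve needs `tau n` to be strictly increasing in a, which is the hard part. Let w = ∂u/∂a and o
= w'. It is enough that o has the sign of (-1)^n at the n-th zero of v. Two Wronskians control w:
the one with u, whose derivative has the sign of -w u, and the one with (u - s v)/√s, whose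
derivative has the sign of w (u - s v). `first_swing` and `half_swing` carry the sign information
from one zero of u to the next. Monotonicity makes the first coordinate of the curve an embedding,
and a ≤ tau n a (the force is less than 1) sends the curve to infinity. -/

namespace RotatingChain

open Set Filter Topology MeasureTheory

/-! ### Averages over [0, t]. -/

/-- The mean value of `y` over the segment from `0` to `t`. -/
noncomputable def avg (y : ℝ → ℝ) (t : ℝ) : ℝ := ∫ θ in (0 : ℝ)..1, y (θ * t)

theorem continuous_avg {y : ℝ → ℝ} (hy : Continuous y) : Continuous (avg y) := by
  unfold avg
  apply intervalIntegral.continuous_parametric_intervalIntegral_of_continuous'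
  fun_prop

theorem continuous_avg_param {X : Type*} [TopologicalSpace X] [FirstCountableTopology X]
    {y : X → ℝ → ℝ} (hy : Continuous fun p : X × ℝ => y p.1 p.2) :
    Continuous fun p : X × ℝ => avg (y p.1) p.2 := by
  unfold avg
  apply intervalIntegral.continuous_parametric_intervalIntegral_of_continuous'
  change Continuous fun q : (X × ℝ) × ℝ => y q.1.1 (q.2 * q.1.2)
  exact hy.comp (f := fun q : (X × ℝ) × ℝ => (q.1.1, q.2 * q.1.2)) (by fun_prop)

theorem mul_avg (y : ℝ → ℝ) (t : ℝ) : t * avg y t = ∫ x in (0 : ℝ)..t, y x := by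
  unfold avg
  rw [intervalIntegral.mul_integral_comp_mul_right]
  simp

theorem avg_zero (y : ℝ → ℝ) : avg y 0 = y 0 := by
  simp [avg]

theorem avg_congr {y₁ y₂ : ℝ → ℝ} {t : ℝ} (ht : 0 ≤ t) (h : ∀ x ∈ Icc 0 t, y₁ x = y₂ x) :
    avg y₁ t = avg y₂ t := by
  unfold avg
  apply intervalIntegral.integral_congr
  intro θ hθ
  rw [uIcc_of_le zero_le_one] at hθ
  exact h _ ⟨mul_nonneg hθ.1 ht, mul_le_of_le_one_left ht hθ.2⟩

theorem avg_const_mul (c : ℝ) (y : ℝ → ℝ) (t : ℝ) : avg (fun x => c * y x) t = c * avg y t := by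
  simp [avg]

theorem avg_add {y₁ y₂ : ℝ → ℝ} (h₁ : Continuous y₁) (h₂ : Continuous y₂) (t : ℝ) :
    avg (fun x => y₁ x + y₂ x) t = avg y₁ t + avg y₂ t := by
  unfold avg
  apply intervalIntegral.integral_add <;> apply Continuous.intervalIntegrable <;> fun_prop

theorem avg_sub {y₁ y₂ : ℝ → ℝ} (h₁ : Continuous y₁) (h₂ : Continuous y₂) (t : ℝ) :
    avg (fun x => y₁ x - y₂ x) t = avg y₁ t - avg y₂ t := by
  unfold avg
  apply intervalIntegral.integral_sub <;> apply Continuous.intervalIntegrable <;> fun_prop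

theorem abs_avg_le {y : ℝ → ℝ} {t C : ℝ} (ht : 0 ≤ t) (h : ∀ x ∈ Icc 0 t, |y x| ≤ C) :
    |avg y t| ≤ C := by
  have := intervalIntegral.norm_integral_le_of_norm_le_const (a := (0 : ℝ)) (b := 1) (C := C)
    (f := fun θ => y (θ * t)) (by
      intro θ hθ
      rw [uIoc_of_le zero_le_one] at hθ
      exact h _ ⟨mul_nonneg hθ.1.le ht, mul_le_of_le_one_left ht hθ.2⟩)
  simpa [avg] using this

theorem hasDerivAt_mul_avg {y : ℝ → ℝ} (hy : Continuous y) (s : ℝ) :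
    HasDerivAt (fun t => t * avg y t) (y s) s := by
  simp_rw [mul_avg]
  exact intervalIntegral.integral_hasDerivAt_right (hy.intervalIntegrable _ _)
    hy.stronglyMeasurable.stronglyMeasurableAtFilter hy.continuousAt

theorem integral_mul_exp_two (K s : ℝ) :
    ∫ t in (0 : ℝ)..s, K * Real.exp (2 * t) = K * (Real.exp (2 * s) - 1) / 2 := by
  have h : ∀ t ∈ uIcc 0 s, HasDerivAt (fun t => K * Real.exp (2 * t) / 2) (K * Real.exp (2 * t)) t := by
    intro t _
    exact (((((hasDerivAt_id' t).const_mul 2).exp).const_mul K).div_const 2).congr_deriv (by ring)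
  rw [intervalIntegral.integral_eq_sub_of_hasDerivAt h (by
    apply Continuous.intervalIntegrable; fun_prop)]
  simp; ring

/-! ### Volterra equations driven by the average: stability, uniqueness, existence. -/

/-- `y` is continuous and solves `y s = c - ∫₀ˢ G t (avg y t) dt` for `s ≥ 0`. -/
structure IsVolterra (c : ℝ) (G : ℝ → ℝ → ℝ) (y : ℝ → ℝ) : Prop where
  cont : Continuous y
  eq : ∀ s, 0 ≤ s → y s = c - ∫ t in (0 : ℝ)..s, G t (avg y t)

theorem IsVolterra.zero {c : ℝ} {G : ℝ → ℝ → ℝ} {y : ℝ → ℝ} (h : IsVolterra c G y) : y 0 = c := by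
  simpa using h.eq 0 le_rfl

theorem continuous_comp_avg {G : ℝ → ℝ → ℝ} (hG : Continuous fun p : ℝ × ℝ => G p.1 p.2)
    {y : ℝ → ℝ} (hy : Continuous y) : Continuous fun t => G t (avg y t) :=
  hG.comp (f := fun t => (t, avg y t)) (continuous_id.prodMk (continuous_avg hy))

/-- Solutions of Volterra equations depend continuously on the data. -/
theorem IsVolterra.abs_sub_le {c₁ c₂ : ℝ} {G₁ G₂ : ℝ → ℝ → ℝ} {y₁ y₂ : ℝ → ℝ}
    (h₁ : IsVolterra c₁ G₁ y₁) (h₂ : IsVolterra c₂ G₂ y₂)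
    (hG₁ : Continuous fun p : ℝ × ℝ => G₁ p.1 p.2) (hG₂ : Continuous fun p : ℝ × ℝ => G₂ p.1 p.2)
    (hlip : ∀ t x x', |G₂ t x - G₂ t x'| ≤ |x - x'|) {S δ ε : ℝ} (hδ0 : 0 ≤ δ)
    (hδ : ∀ t ∈ Icc 0 S, |G₁ t (avg y₁ t) - G₂ t (avg y₁ t)| ≤ δ)
    (hε : |c₁ - c₂| + S * δ ≤ ε) {s : ℝ} (hs : s ∈ Icc 0 S) :
    |y₁ s - y₂ s| ≤ 2 * ε * Real.exp (2 * s) := by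
  have hS : 0 ≤ S := hs.1.trans hs.2
  -- In place of Gronwall's inequality: bound the difference by K e^{2t}, where K is the maximum of
  -- the weighted difference, and feed this back into the equations at the maximum point m. Since
  -- ∫₀ᵐ e^{2t} < e^{2m}/2, half of K is absorbed.
  have hcont : ContinuousOn (fun t => Real.exp (-(2 * t)) * |y₁ t - y₂ t|) (Icc 0 S) := by
    have := h₁.cont; have := h₂.cont
    fun_prop
  obtain ⟨m, hm, hmax⟩ := isCompact_Icc.exists_isMaxOn (nonempty_Icc.2 hS) hcont
  set K := Real.exp (-(2 * m)) * |y₁ m - y₂ m| with hK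
  have hK0 : 0 ≤ K := by positivity
  have hle : ∀ t ∈ Icc 0 S, |y₁ t - y₂ t| ≤ K * Real.exp (2 * t) := by
    intro t ht
    have h : Real.exp (-(2 * t)) * |y₁ t - y₂ t| ≤ K := hmax ht
    have e : Real.exp (-(2 * t)) * Real.exp (2 * t) = 1 := by
      rw [← Real.exp_add]; simp
    calc |y₁ t - y₂ t| = Real.exp (-(2 * t)) * |y₁ t - y₂ t| * Real.exp (2 * t) := by
          rw [mul_right_comm, e, one_mul]
      _ ≤ _ := by gcongr
  have havg : ∀ t ∈ Icc 0 S, |avg y₁ t - avg y₂ t| ≤ K * Real.exp (2 * t) := by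
    intro t ht
    rw [← avg_sub h₁.cont h₂.cont]
    apply abs_avg_le ht.1
    intro x hx
    refine (hle x ⟨hx.1, hx.2.trans ht.2⟩).trans ?_
    have := hx.2
    gcongr
  have hint : |∫ t in (0 : ℝ)..m, (G₁ t (avg y₁ t) - G₂ t (avg y₂ t))|
      ≤ ∫ t in (0 : ℝ)..m, (δ + K * Real.exp (2 * t)) := by
    have := intervalIntegral.norm_integral_le_of_norm_le (μ := volume) hm.1
      (f := fun t => G₁ t (avg y₁ t) - G₂ t (avg y₂ t))
      (g := fun t => δ + K * Real.exp (2 * t)) ?_ ?_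
    · simpa using this
    · refine Eventually.of_forall fun t ht => ?_
      have ht' : t ∈ Icc 0 S := ⟨ht.1.le, ht.2.trans hm.2⟩
      calc |G₁ t (avg y₁ t) - G₂ t (avg y₂ t)|
          ≤ |G₁ t (avg y₁ t) - G₂ t (avg y₁ t)| + |G₂ t (avg y₁ t) - G₂ t (avg y₂ t)| :=
            _root_.abs_sub_le _ _ _
        _ ≤ _ := add_le_add (hδ t ht') ((hlip _ _ _).trans (havg t ht'))
    · apply Continuous.intervalIntegrable; fun_prop
  have hm' : |y₁ m - y₂ m| ≤ |c₁ - c₂| + ∫ t in (0 : ℝ)..m, (δ + K * Real.exp (2 * t)) := by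
    rw [h₁.eq m hm.1, h₂.eq m hm.1]
    rw [intervalIntegral.integral_sub
      ((continuous_comp_avg hG₁ h₁.cont).intervalIntegrable _ _)
      ((continuous_comp_avg hG₂ h₂.cont).intervalIntegrable _ _)] at hint
    set I₁ := ∫ t in (0 : ℝ)..m, G₁ t (avg y₁ t)
    set I₂ := ∫ t in (0 : ℝ)..m, G₂ t (avg y₂ t)
    have e : c₁ - I₁ - (c₂ - I₂) = (c₁ - c₂) - (I₁ - I₂) := by ring
    rw [e]
    exact (abs_sub _ _).trans (add_le_add le_rfl hint)
  rw [intervalIntegral.integral_add (by simp) (by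
    apply Continuous.intervalIntegrable; fun_prop), integral_mul_exp_two] at hm'
  simp only [intervalIntegral.integral_const, sub_zero, smul_eq_mul] at hm'
  have hmδ : m * δ ≤ S * δ := by have := hm.2; gcongr
  have hKm : |y₁ m - y₂ m| = K * Real.exp (2 * m) := by
    rw [hK, mul_right_comm, ← Real.exp_add]; simp
  have h1 : 1 ≤ Real.exp (2 * m) := Real.one_le_exp (by linarith [hm.1])
  have h2 : K ≤ 2 * ε := by
    have : K * 1 ≤ K * Real.exp (2 * m) := by gcongr
    linarith
  exact (hle s hs).trans (by gcongr)

theorem IsVolterra.eqOn {c : ℝ} {G : ℝ → ℝ → ℝ} {y₁ y₂ : ℝ → ℝ}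
    (h₁ : IsVolterra c G y₁) (h₂ : IsVolterra c G y₂)
    (hG : Continuous fun p : ℝ × ℝ => G p.1 p.2)
    (hlip : ∀ t x x', |G t x - G t x'| ≤ |x - x'|) {s : ℝ} (hs : 0 ≤ s) : y₁ s = y₂ s := by
  have := h₁.abs_sub_le h₂ hG hG hlip (S := s) (δ := 0) (ε := 0) le_rfl (by simp) (by simp)
    ⟨hs, le_rfl⟩
  rw [← sub_eq_zero, ← abs_nonpos_iff]
  simpa using this

open BoundedContinuousFunction in
/-- Global solvability of Volterra equations, with a solution constant on the negative axis. -/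
theorem exists_isVolterra (c : ℝ) {G : ℝ → ℝ → ℝ} (hG : Continuous fun p : ℝ × ℝ => G p.1 p.2)
    (hlip : ∀ t x x', |G t x - G t x'| ≤ |x - x'|) (h0 : ∀ t, G t 0 = 0) :
    ∃ y, IsVolterra c G y ∧ ∀ s ≤ 0, y s = c := by
  -- The unknown is y = e^{2t} z with z bounded. Under this weight the integral operator contracts
  -- by 1/2 on the whole half-line, so one fixed point gives a global solution. The `max t 0`
  -- extends it by a constant to negative times.
  let Y : (ℝ →ᵇ ℝ) → ℝ → ℝ := fun z t => Real.exp (2 * max t 0) * z (max t 0)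
  have hY : ∀ z, Continuous (Y z) := fun z => by
    have := z.continuous
    fun_prop
  have hYsub : ∀ z₁ z₂ t, 0 ≤ t → |avg (Y z₁) t - avg (Y z₂) t| ≤ dist z₁ z₂ * Real.exp (2 * t) := by
    intro z₁ z₂ t ht
    rw [← avg_sub (hY _) (hY _)]
    apply abs_avg_le ht
    intro x hx
    simp only [Y, max_eq_left hx.1]
    rw [← mul_sub, abs_mul, abs_of_pos (Real.exp_pos _), mul_comm]
    have h1 : |z₁ x - z₂ x| ≤ dist z₁ z₂ := by
      rw [← Real.dist_eq]; exact dist_coe_le_dist x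
    have := hx.2
    gcongr
  let I : (ℝ →ᵇ ℝ) → ℝ → ℝ := fun z s => ∫ t in (0 : ℝ)..s, G t (avg (Y z) t)
  have hI : ∀ z, Continuous (I z) := fun z =>
    intervalIntegral.continuous_primitive
      (fun a b => (continuous_comp_avg hG (hY z)).intervalIntegrable a b) 0
  have hIsub : ∀ z₁ z₂ s, 0 ≤ s → |I z₁ s - I z₂ s| ≤ dist z₁ z₂ * (Real.exp (2 * s) - 1) / 2 := by
    intro z₁ z₂ s hs
    simp only [I]
    rw [← intervalIntegral.integral_sub
      ((continuous_comp_avg hG (hY z₁)).intervalIntegrable _ _)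
      ((continuous_comp_avg hG (hY z₂)).intervalIntegrable _ _), ← integral_mul_exp_two]
    rw [← Real.norm_eq_abs]
    apply intervalIntegral.norm_integral_le_of_norm_le hs
    · exact Eventually.of_forall fun t ht => (hlip _ _ _).trans (hYsub z₁ z₂ t ht.1.le)
    · apply Continuous.intervalIntegrable; fun_prop
  have hI0 : ∀ s, I 0 s = 0 := by
    intro s
    have : ∀ t, avg (Y 0) t = 0 := fun t => by simp [avg, Y]
    simp [I, this, h0]
  have hexp : ∀ s : ℝ, Real.exp (-(2 * max s 0)) * Real.exp (2 * max s 0) = 1 := fun s => by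
    rw [← Real.exp_add]; simp
  let Ψ : (ℝ →ᵇ ℝ) → (ℝ →ᵇ ℝ) := fun z =>
    BoundedContinuousFunction.ofNormedAddCommGroup
      (fun s => Real.exp (-(2 * max s 0)) * (c - I z (max s 0)))
      (by have := hI z; fun_prop) (|c| + dist z 0) (by
        intro s
        have hs : (0 : ℝ) ≤ max s 0 := le_max_right _ _
        have h1 : Real.exp (-(2 * max s 0)) ≤ 1 := Real.exp_le_one_iff.2 (by linarith)
        have h2 := hIsub z 0 _ hs
        rw [hI0, sub_zero] at h2
        have h3 := hexp s
        have h4 : (0:ℝ) ≤ dist z 0 := dist_nonneg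
        rw [Real.norm_eq_abs, abs_mul, abs_of_pos (Real.exp_pos _)]
        have h5 : |c - I z (max s 0)| ≤ |c| + dist z 0 * Real.exp (2 * max s 0) := by
          refine (abs_sub _ _).trans (add_le_add le_rfl (h2.trans ?_))
          have := Real.exp_pos (2 * max s 0)
          nlinarith
        have h6 := Real.exp_pos (-(2 * max s 0))
        calc _ ≤ Real.exp (-(2 * max s 0)) * (|c| + dist z 0 * Real.exp (2 * max s 0)) := by
              gcongr
          _ = Real.exp (-(2 * max s 0)) * |c| + dist z 0 *
              (Real.exp (-(2 * max s 0)) * Real.exp (2 * max s 0)) := by ring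
          _ ≤ 1 * |c| + dist z 0 * 1 := by rw [h3]; gcongr
          _ = _ := by ring)
  have hΨ : ContractingWith (1 / 2) Ψ := by
    refine ⟨by norm_num, LipschitzWith.of_dist_le_mul fun z₁ z₂ => ?_⟩
    rw [BoundedContinuousFunction.dist_le (by positivity)]
    intro s
    have hs : (0 : ℝ) ≤ max s 0 := le_max_right _ _
    have h2 := hIsub z₁ z₂ _ hs
    have h6 := Real.exp_pos (-(2 * max s 0))
    have h4 : (0:ℝ) ≤ dist z₁ z₂ := dist_nonneg
    simp only [Ψ, BoundedContinuousFunction.coe_ofNormedAddCommGroup, Real.dist_eq]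
    rw [← mul_sub, abs_mul, abs_of_pos h6, sub_sub_sub_cancel_left, abs_sub_comm]
    calc _ ≤ Real.exp (-(2 * max s 0)) * (dist z₁ z₂ * Real.exp (2 * max s 0) / 2) := by
          gcongr
          refine h2.trans ?_
          linarith
      _ = dist z₁ z₂ * (Real.exp (-(2 * max s 0)) * Real.exp (2 * max s 0)) / 2 := by ring
      _ = _ := by rw [hexp]; push_cast; ring
  obtain ⟨z, hz⟩ : ∃ z, Ψ z = z := ⟨_, hΨ.fixedPoint_isFixedPt⟩
  have key : ∀ s, 0 ≤ s → Y z s = c - I z s := by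
    intro s hs
    have h1 : z s = Real.exp (-(2 * max s 0)) * (c - I z (max s 0)) := by
      conv_lhs => rw [← hz]
      rfl
    have h3 := hexp s
    simp only [Y]
    rw [max_eq_left hs] at h1 h3 ⊢
    rw [h1, ← mul_assoc, mul_comm (Real.exp (2 * s)), h3, one_mul]
  refine ⟨Y z, ⟨hY z, key⟩, fun s hs => ?_⟩
  have : Y z s = Y z 0 := by simp [Y, max_eq_right hs]
  rw [this, key 0 le_rfl]
  simp [I]

theorem IsVolterra.hasDerivAt {c : ℝ} {G : ℝ → ℝ → ℝ} {y : ℝ → ℝ} (h : IsVolterra c G y)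
    (hG : Continuous fun p : ℝ × ℝ => G p.1 p.2) {s : ℝ} (hs : 0 < s) :
    HasDerivAt y (-G s (avg y s)) s := by
  have hc := continuous_comp_avg hG h.cont
  have h1 : HasDerivAt (fun s => c - ∫ t in (0 : ℝ)..s, G t (avg y t)) (-G s (avg y s)) s :=
    (intervalIntegral.integral_hasDerivAt_right (hc.intervalIntegrable _ _)
      hc.stronglyMeasurable.stronglyMeasurableAtFilter hc.continuousAt).const_sub c
  refine h1.congr_of_eventuallyEq ?_
  filter_upwards [lt_mem_nhds hs] with t ht using h.eq t ht.le

/-! ### The restoring force and its derivative. -/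

/-- The function `1 / √(1 + x²)`. -/
noncomputable def invHyp (x : ℝ) : ℝ := (√(1 + x ^ 2))⁻¹

theorem invHyp_pos (x : ℝ) : 0 < invHyp x := by unfold invHyp; positivity

theorem invHyp_le_one (x : ℝ) : invHyp x ≤ 1 := by
  unfold invHyp
  exact inv_le_one_of_one_le₀ (Real.one_le_sqrt.2 (by nlinarith [sq_nonneg x]))

theorem invHyp_sq (x : ℝ) : invHyp x ^ 2 * (1 + x ^ 2) = 1 := by
  have h : (0 : ℝ) < 1 + x ^ 2 := by positivity
  unfold invHyp
  rw [inv_pow, Real.sq_sqrt h.le, inv_mul_cancel₀ h.ne']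

theorem continuous_invHyp : Continuous invHyp := by
  unfold invHyp
  exact (by fun_prop : Continuous fun x : ℝ => √(1 + x ^ 2)).inv₀ fun x => by positivity

theorem hasDerivAt_invHyp (x : ℝ) : HasDerivAt invHyp (-(x * invHyp x ^ 3)) x := by
  have h : (0 : ℝ) < 1 + x ^ 2 := by positivity
  have h1 : HasDerivAt (fun x : ℝ => 1 + x ^ 2) (2 * x) x := by
    simpa using (hasDerivAt_pow 2 x).const_add 1
  have h2 := (h1.sqrt h.ne').inv (by positivity)
  refine h2.congr_deriv ?_
  have h3 : 0 < √(1 + x ^ 2) := by positivity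
  simp only [invHyp]
  field_simp

theorem abs_invHyp_sub_le (x x' : ℝ) : |invHyp x - invHyp x'| ≤ |x - x'| := by
  have := Convex.norm_image_sub_le_of_norm_hasDerivWithin_le (f := invHyp)
    (f' := fun x => -(x * invHyp x ^ 3)) (C := 1) (s := univ) (x := x') (y := x)
    (fun x _ => (hasDerivAt_invHyp x).hasDerivWithinAt) (fun x _ => ?_) convex_univ trivial trivial
  · simpa using this
  · have h1 := invHyp_pos x
    have h2 := invHyp_le_one x
    have h3 := invHyp_sq x
    rw [Real.norm_eq_abs, abs_le]
    have h4 : |x * invHyp x| ≤ 1 := by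
      rw [← sq_le_one_iff_abs_le_one]; nlinarith [sq_nonneg (invHyp x)]
    rw [abs_le] at h4
    have h5 : x * invHyp x ^ 3 = (x * invHyp x) * invHyp x ^ 2 := by ring
    have h6 : invHyp x ^ 2 ≤ 1 := pow_le_one₀ h1.le h2
    have h7 : 0 < invHyp x ^ 2 := by positivity
    constructor <;> nlinarith

/-- The restoring force `ρ / √(1 + κ² ρ²)`. -/
noncomputable def pull (κ ρ : ℝ) : ℝ := ρ * invHyp (κ * ρ)

theorem continuous_pull : Continuous fun p : ℝ × ℝ => pull p.1 p.2 := by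
  unfold pull
  have := continuous_invHyp
  fun_prop

theorem continuous_pull_const (κ : ℝ) : Continuous fun p : ℝ × ℝ => pull κ p.2 :=
  continuous_pull.comp (f := fun p : ℝ × ℝ => (κ, p.2)) (by fun_prop)

theorem pull_zero (κ : ℝ) : pull κ 0 = 0 := by simp [pull]

theorem pull_neg (κ ρ : ℝ) : pull κ (-ρ) = -pull κ ρ := by simp [pull, invHyp]

theorem pull_pos {κ ρ : ℝ} (h : 0 < ρ) : 0 < pull κ ρ := mul_pos h (invHyp_pos _)

/-- This scaling moves the initial slope out of the unknown and into the parameter of the force,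
where it may be set to 0. -/
theorem pull_one_mul (κ ρ : ℝ) : pull 1 (κ * ρ) = κ * pull κ ρ := by
  simp [pull, mul_assoc]

theorem abs_pull_one_le (ρ : ℝ) : |pull 1 ρ| < 1 := by
  have h3 := invHyp_sq ρ
  have h1 := invHyp_pos ρ
  rw [← sq_lt_one_iff_abs_lt_one, pull, one_mul]
  nlinarith [sq_pos_of_pos h1]

/-- The singularity at s = 0 disappears here: the force depends on u and s through u/s alone, and
u/s is the average of u' over [0, s]. -/
theorem pull_div {κ s : ℝ} (hs : 0 < s) (u : ℝ) : pull κ (u / s) = u / √(s ^ 2 + κ ^ 2 * u ^ 2) := by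
  have h : s ^ 2 + κ ^ 2 * u ^ 2 = s ^ 2 * (1 + (κ * (u / s)) ^ 2) := by
    field_simp
  rw [h, Real.sqrt_mul (by positivity), Real.sqrt_sq hs.le, pull, invHyp]
  field_simp

theorem hasDerivAt_pull (κ ρ : ℝ) : HasDerivAt (pull κ) (invHyp (κ * ρ) ^ 3) ρ := by
  have h1 : HasDerivAt (fun x => invHyp (κ * x)) (-(κ * ρ * invHyp (κ * ρ) ^ 3) * κ) ρ :=
    (hasDerivAt_invHyp (κ * ρ)).comp ρ (by simpa using (hasDerivAt_id' ρ).const_mul κ)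
  refine ((hasDerivAt_id' ρ).mul h1).congr_deriv ?_
  have := invHyp_sq (κ * ρ)
  linear_combination (-invHyp (κ * ρ)) * this

theorem abs_pull_sub_le (κ x x' : ℝ) : |pull κ x - pull κ x'| ≤ |x - x'| := by
  have := Convex.norm_image_sub_le_of_norm_hasDerivWithin_le (f := pull κ)
    (f' := fun x => invHyp (κ * x) ^ 3) (C := 1) (s := univ) (x := x') (y := x)
    (fun x _ => (hasDerivAt_pull κ x).hasDerivWithinAt) (fun x _ => ?_) convex_univ trivial trivial
  · simpa using this
  · have h1 := invHyp_pos (κ * x)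
    rw [Real.norm_eq_abs, abs_of_pos (by positivity)]
    exact pow_le_one₀ h1.le (invHyp_le_one _)

theorem abs_pull_sub_pull_le (κ κ' ρ : ℝ) : |pull κ ρ - pull κ' ρ| ≤ |κ - κ'| * ρ ^ 2 := by
  have := abs_invHyp_sub_le (κ * ρ) (κ' * ρ)
  rw [← sub_mul, abs_mul] at this
  rw [pull, pull, ← mul_sub, abs_mul]
  calc _ ≤ |ρ| * (|κ - κ'| * |ρ|) := by gcongr
    _ = |κ - κ'| * |ρ| ^ 2 := by ring
    _ = _ := by rw [sq_abs]

/-- The derivative `invHyp ^ 3` is 3-Lipschitz, because `invHyp` is 1-Lipschitz with values in (0,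
1]; the mean value inequality on the segment from r to x then gives a quadratic remainder. -/
theorem abs_pull_one_taylor_le (x r : ℝ) :
    |pull 1 x - (pull 1 r + invHyp r ^ 3 * (x - r))| ≤ 3 * (x - r) ^ 2 := by
  have hcube : ∀ y, |invHyp y ^ 3 - invHyp r ^ 3| ≤ 3 * |y - r| := by
    intro y
    have h1 := invHyp_pos y
    have h2 := invHyp_le_one y
    have h3 := invHyp_pos r
    have h4 := invHyp_le_one r
    have e : invHyp y ^ 3 - invHyp r ^ 3 =
      (invHyp y ^ 2 + invHyp y * invHyp r + invHyp r ^ 2) * (invHyp y - invHyp r) := by ring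
    rw [e, abs_mul, abs_of_pos (by positivity)]
    have h5 : invHyp y ^ 2 + invHyp y * invHyp r + invHyp r ^ 2 ≤ 3 := by nlinarith
    exact mul_le_mul h5 (abs_invHyp_sub_le _ _) (abs_nonneg _) (by norm_num)
  have := Convex.norm_image_sub_le_of_norm_hasDerivWithin_le
    (f := fun y => pull 1 y - (pull 1 r + invHyp r ^ 3 * (y - r)))
    (f' := fun y => invHyp y ^ 3 - invHyp r ^ 3) (C := 3 * |x - r|) (s := uIcc r x)
    (x := r) (y := x) (fun y _ => ?_) (fun y hy => ?_) (convex_uIcc _ _) left_mem_uIcc right_mem_uIcc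
  · simp only [sub_self, mul_zero, add_zero, sub_zero, Real.norm_eq_abs] at this
    calc _ ≤ 3 * |x - r| * |x - r| := this
      _ = 3 * |x - r| ^ 2 := by ring
      _ = _ := by rw [sq_abs]
  · have h1 := hasDerivAt_pull 1 y
    rw [one_mul] at h1
    have h2 : HasDerivAt (fun y => pull 1 r + invHyp r ^ 3 * (y - r)) (invHyp r ^ 3) y := by
      simpa using (((hasDerivAt_id' y).sub_const r).const_mul (invHyp r ^ 3)).const_add (pull 1 r)
    exact (h1.sub h2).hasDerivWithinAt
  · refine (hcube y).trans ?_
    have : |y - r| ≤ |x - r| := abs_sub_left_of_mem_uIcc hy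
    gcongr

/-! ### The profile, its continuity in the initial slope, and shots. -/

/-- The normalised profile: the solution of `y s = 1 - ∫₀ˢ pull a (avg y t) dt`. -/
noncomputable def prof (a : ℝ) : ℝ → ℝ :=
  (exists_isVolterra 1 (continuous_pull_const a) (fun _ => abs_pull_sub_le a)
    (fun _ => pull_zero a)).choose

theorem prof_spec (a : ℝ) : IsVolterra 1 (fun _ ρ => pull a ρ) (prof a) :=
  (exists_isVolterra 1 (continuous_pull_const a) (fun _ => abs_pull_sub_le a)
    (fun _ => pull_zero a)).choose_spec.1

theorem prof_of_nonpos (a : ℝ) {s : ℝ} (hs : s ≤ 0) : prof a s = 1 :=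
  (exists_isVolterra 1 (continuous_pull_const a) (fun _ => abs_pull_sub_le a)
    (fun _ => pull_zero a)).choose_spec.2 s hs

/-- The primitive of the profile. -/
noncomputable def prim (a s : ℝ) : ℝ := s * avg (prof a) s

theorem prof_zero (a : ℝ) : prof a 0 = 1 := prof_of_nonpos a le_rfl

theorem prim_zero (a : ℝ) : prim a 0 = 0 := by simp [prim]

theorem hasDerivAt_prim (a s : ℝ) : HasDerivAt (prim a) (prof a s) s :=
  hasDerivAt_mul_avg (prof_spec a).cont s

theorem prim_div (a : ℝ) {s : ℝ} (hs : s ≠ 0) : prim a s / s = avg (prof a) s := by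
  rw [prim, mul_div_cancel_left₀ _ hs]

theorem hasDerivAt_prof (a : ℝ) {s : ℝ} (hs : 0 < s) :
    HasDerivAt (prof a) (-pull a (prim a s / s)) s := by
  rw [prim_div a hs.ne']
  exact (prof_spec a).hasDerivAt (continuous_pull_const a) hs

theorem abs_prof_le (a : ℝ) {s : ℝ} (hs : 0 ≤ s) : |prof a s| ≤ 2 * Real.exp (2 * s) := by
  have h0 : IsVolterra 0 (fun _ ρ => pull a ρ) (fun _ => 0) :=
    ⟨continuous_const, fun s _ => by simp [avg, pull_zero]⟩
  have := (prof_spec a).abs_sub_le h0 (continuous_pull_const a) (continuous_pull_const a)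
    (fun _ => abs_pull_sub_le a) (S := s) (δ := 0) (ε := 1) le_rfl (by simp) (by simp) ⟨hs, le_rfl⟩
  simpa using this

theorem abs_prof_sub_le (a b : ℝ) {s S : ℝ} (hs : s ≤ S) (hS : 0 ≤ S) :
    |prof a s - prof b s| ≤
      2 * (S * (|a - b| * (2 * Real.exp (2 * S)) ^ 2)) * Real.exp (2 * S) := by
  rcases le_total s 0 with h | h
  · rw [prof_of_nonpos a h, prof_of_nonpos b h]
    simp only [sub_self, abs_zero]
    positivity
  have := (prof_spec a).abs_sub_le (prof_spec b) (continuous_pull_const a) (continuous_pull_const b)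
    (fun _ => abs_pull_sub_le b) (S := S) (δ := |a - b| * (2 * Real.exp (2 * S)) ^ 2)
    (ε := S * (|a - b| * (2 * Real.exp (2 * S)) ^ 2)) (by positivity) (fun t ht => ?_) (by simp)
    ⟨h, hs⟩
  · refine this.trans ?_
    gcongr
  · refine (abs_pull_sub_pull_le _ _ _).trans ?_
    have : |avg (prof a) t| ≤ 2 * Real.exp (2 * S) := by
      apply abs_avg_le ht.1
      intro x hx
      refine (abs_prof_le a hx.1).trans ?_
      have := hx.2.trans ht.2
      gcongr
    rw [← sq_abs (avg (prof a) t)]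
    gcongr

theorem continuous_prof : Continuous fun p : ℝ × ℝ => prof p.1 p.2 := by
  rw [continuous_iff_continuousAt]
  rintro ⟨a, s⟩
  have h1 : Tendsto (fun p : ℝ × ℝ => prof a p.2) (𝓝 (a, s)) (𝓝 (prof a s)) :=
    ((prof_spec a).cont.comp continuous_snd).tendsto (a, s)
  have h2 : Tendsto (fun p : ℝ × ℝ => prof p.1 p.2 - prof a p.2) (𝓝 (a, s)) (𝓝 0) := by
    set S := |s| + 1
    have hS : 0 ≤ S := by positivity
    rw [tendsto_zero_iff_abs_tendsto_zero]
    have hc : Tendsto (fun p : ℝ × ℝ =>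
        2 * (S * (|p.1 - a| * (2 * Real.exp (2 * S)) ^ 2)) * Real.exp (2 * S)) (𝓝 (a, s)) (𝓝 0) := by
      have : Continuous (fun p : ℝ × ℝ =>
        2 * (S * (|p.1 - a| * (2 * Real.exp (2 * S)) ^ 2)) * Real.exp (2 * S)) := by fun_prop
      simpa using this.tendsto (a, s)
    refine tendsto_of_tendsto_of_tendsto_of_le_of_le' tendsto_const_nhds hc
      (Eventually.of_forall fun p => abs_nonneg _) ?_
    have hlt : s < S := by simp only [S]; linarith [le_abs_self s]
    filter_upwards [(continuous_snd.tendsto (a, s)).eventually (gt_mem_nhds hlt)] with p hp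
    exact abs_prof_sub_le p.1 a (le_of_lt hp) hS
  have := h2.add h1
  simpa [ContinuousAt] using this

theorem continuous_avg_prof : Continuous fun p : ℝ × ℝ => avg (prof p.1) p.2 :=
  continuous_avg_param continuous_prof

theorem continuous_prim : Continuous fun p : ℝ × ℝ => prim p.1 p.2 :=
  continuous_snd.mul continuous_avg_prof

/-- `(u, v)` solves `u' = v`, `v' = -u / √(s² + κ² u²)` on `(0, T)`, continuously up to `T`. -/
structure IsBranch (κ T : ℝ) (u v : ℝ → ℝ) : Prop where
  cont_u : ContinuousOn u (Ioc 0 T)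
  cont_v : ContinuousOn v (Ioc 0 T)
  deriv_u : ∀ s ∈ Ioo 0 T, HasDerivAt u (v s) s
  deriv_v : ∀ s ∈ Ioo 0 T, HasDerivAt v (-pull κ (u s / s)) s

/-- Two solutions that agree at `T` agree on `(0, T]`. -/
theorem IsBranch.eqOn {κ T : ℝ} {u₁ v₁ u₂ v₂ : ℝ → ℝ} (h₁ : IsBranch κ T u₁ v₁)
    (h₂ : IsBranch κ T u₂ v₂) (hu : u₁ T = u₂ T) (hv : v₁ T = v₂ T) {s : ℝ} (hs : s ∈ Ioc 0 T) :
    u₁ s = u₂ s ∧ v₁ s = v₂ s := by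
  obtain ⟨hs0, hsT⟩ := hs
  -- On [s, T] the force is Lipschitz in u with constant at most 1/s, so the squared distance of the
  -- two solutions decays no faster than e^{-Ct}. Thus `E` is nondecreasing; it vanishes at T, hence
  -- before T.
  set C := 1 + 1 / s with hC
  let E : ℝ → ℝ := fun t => ((u₁ t - u₂ t) ^ 2 + (v₁ t - v₂ t) ^ 2) * Real.exp (C * t)
  have hsub : Icc s T ⊆ Ioc 0 T := fun t ht => ⟨hs0.trans_le ht.1, ht.2⟩
  have hmono : MonotoneOn E (Icc s T) := by
    apply monotoneOn_of_hasDerivWithinAt_nonneg (convex_Icc s T)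
      (f' := fun t => (2 * (u₁ t - u₂ t) * (v₁ t - v₂ t) + 2 * (v₁ t - v₂ t) *
        (-pull κ (u₁ t / t) - -pull κ (u₂ t / t))) * Real.exp (C * t) +
        ((u₁ t - u₂ t) ^ 2 + (v₁ t - v₂ t) ^ 2) * (Real.exp (C * t) * C))
    · have a1 := h₁.cont_u.mono hsub
      have a2 := h₁.cont_v.mono hsub
      have a3 := h₂.cont_u.mono hsub
      have a4 := h₂.cont_v.mono hsub
      fun_prop
    · intro t ht
      rw [interior_Icc] at ht
      have ht' : t ∈ Ioo 0 T := ⟨hs0.trans ht.1, ht.2⟩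
      have d1 := ((h₁.deriv_u t ht').sub (h₂.deriv_u t ht')).pow 2
      have d2 := ((h₁.deriv_v t ht').sub (h₂.deriv_v t ht')).pow 2
      have d3 : HasDerivAt (fun t => Real.exp (C * t)) (Real.exp (C * t) * C) t := by
        simpa using ((hasDerivAt_id' t).const_mul C).exp
      refine (((d1.add d2).mul d3).congr_deriv ?_).hasDerivWithinAt
      simp
    · intro t ht
      rw [interior_Icc] at ht
      have ht0 : 0 < t := hs0.trans ht.1
      have hp : |pull κ (u₁ t / t) - pull κ (u₂ t / t)| ≤ |u₁ t - u₂ t| * (1 / s) := by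
        refine (abs_pull_sub_le _ _ _).trans ?_
        rw [← sub_div, abs_div, abs_of_pos ht0, div_eq_mul_one_div]
        have := ht.1.le
        gcongr
      set p := u₁ t - u₂ t
      set q := v₁ t - v₂ t
      set d := pull κ (u₁ t / t) - pull κ (u₂ t / t) with hd
      have e : -pull κ (u₁ t / t) - -pull κ (u₂ t / t) = -d := by rw [hd]; ring
      rw [e]
      have h1 : |2 * p * q| ≤ p ^ 2 + q ^ 2 := by
        rw [abs_le]; constructor <;> nlinarith [sq_nonneg (p - q), sq_nonneg (p + q)]
      have h2 : |2 * q * d| ≤ (p ^ 2 + q ^ 2) * (1 / s) := by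
        rw [abs_mul, abs_mul, abs_two]
        have : 2 * |q| * |p| ≤ p ^ 2 + q ^ 2 := by
          rw [← sq_abs p, ← sq_abs q]; nlinarith [sq_nonneg (|p| - |q|)]
        calc 2 * |q| * |d| ≤ 2 * |q| * (|p| * (1 / s)) := by gcongr
          _ = 2 * |q| * |p| * (1 / s) := by ring
          _ ≤ _ := by gcongr
      have h3 : 0 ≤ 2 * p * q + 2 * q * -d + (p ^ 2 + q ^ 2) * C := by
        rw [abs_le] at h1 h2
        rw [hC]; linarith [h1.1, h2.2]
      have := mul_nonneg h3 (Real.exp_pos (C * t)).le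
      linarith
  have hE := hmono (left_mem_Icc.2 hsT) (right_mem_Icc.2 hsT) hsT
  have hET : E T = 0 := by simp [E, hu, hv]
  rw [hET] at hE
  have h0 : (u₁ s - u₂ s) ^ 2 + (v₁ s - v₂ s) ^ 2 ≤ 0 := by
    by_contra! h
    exact absurd hE (not_le.2 (mul_pos h (Real.exp_pos _)))
  constructor
  · have : (u₁ s - u₂ s) ^ 2 = 0 := by nlinarith [sq_nonneg (u₁ s - u₂ s), sq_nonneg (v₁ s - v₂ s)]
    exact sub_eq_zero.1 (pow_eq_zero_iff two_ne_zero |>.1 this)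
  · have : (v₁ s - v₂ s) ^ 2 = 0 := by nlinarith [sq_nonneg (u₁ s - u₂ s), sq_nonneg (v₁ s - v₂ s)]
    exact sub_eq_zero.1 (pow_eq_zero_iff two_ne_zero |>.1 this)

theorem isBranch_prof (a T : ℝ) : IsBranch a T (prim a) (prof a) where
  cont_u := fun s _ => (hasDerivAt_prim a s).continuousAt.continuousWithinAt
  cont_v := (prof_spec a).cont.continuousOn
  deriv_u := fun s _ => hasDerivAt_prim a s
  deriv_v := fun _ hs => hasDerivAt_prof a hs.1

/-- If both vanished at s, backward uniqueness would compare the profile with the zero solution and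
force it to vanish on (0, s], against its limit 1 at the origin. -/
theorem sq_add_sq_pos (a s : ℝ) : 0 < prim a s ^ 2 + prof a s ^ 2 := by
  rcases le_or_gt s 0 with hs | hs
  · rw [prof_of_nonpos a hs]; positivity
  by_contra! hcon
  have hu : prim a s = 0 := by nlinarith [sq_nonneg (prim a s), sq_nonneg (prof a s)]
  have hv : prof a s = 0 := by nlinarith [sq_nonneg (prim a s), sq_nonneg (prof a s)]
  have h0 : IsBranch a s (fun _ => 0) (fun _ => 0) :=
    ⟨continuousOn_const, continuousOn_const, fun t _ => hasDerivAt_const t 0, fun t _ => by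
      simpa [pull_zero] using hasDerivAt_const t (0 : ℝ)⟩
  have h1 : ∀ t ∈ Ioc 0 s, prof a t = 0 := fun t ht =>
    ((isBranch_prof a s).eqOn h0 hu hv ht).2
  have h2 : Tendsto (prof a) (𝓝[>] 0) (𝓝 0) := by
    refine tendsto_const_nhds.congr' ?_
    filter_upwards [Ioc_mem_nhdsGT hs] with t ht using (h1 t ht).symm
  have h3 : Tendsto (prof a) (𝓝[>] 0) (𝓝 1) := by
    have := (prof_spec a).cont.tendsto 0
    rw [prof_zero] at this
    exact this.mono_left nhdsWithin_le_nhds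
  exact zero_ne_one (tendsto_nhds_unique h2 h3)

theorem isVolterra_mul_prof (a : ℝ) :
    IsVolterra a (fun _ ρ => pull 1 ρ) (fun s => a * prof a s) := by
  refine ⟨continuous_const.mul (prof_spec a).cont, fun s hs => ?_⟩
  simp_rw [avg_const_mul, pull_one_mul]
  rw [intervalIntegral.integral_const_mul, (prof_spec a).eq s hs]
  ring

theorem isShot_prof (a : ℝ) : IsShot a (fun s => a * prim a s) (fun s => a * prof a s) where
  u_zero := by simp [prim_zero]
  v_zero := by simp [prof_zero]
  deriv_u := fun s _ => ((hasDerivAt_prim a s).const_mul a).hasDerivWithinAt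
  cont_v := (isVolterra_mul_prof a).cont.continuousOn
  deriv_v := fun s hs => by
    refine ((hasDerivAt_prof a hs).const_mul a).congr_deriv ?_
    have := pull_div (κ := 1) hs (a * prim a s)
    rw [mul_div_assoc, pull_one_mul] at this
    simp only [one_pow, one_mul] at this
    rw [mul_neg, this, mul_div_assoc]

theorem IsShot.isBranch {a : ℝ} {u v : ℝ → ℝ} (h : IsShot a u v) (T : ℝ) : IsBranch 1 T u v where
  cont_u := fun s hs => ((h.deriv_u s hs.1.le).continuousWithinAt).mono fun _ hx => hx.1.le
  cont_v := h.cont_v.mono fun _ hx => hx.1.le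
  deriv_u := fun s hs => (h.deriv_u s hs.1.le).hasDerivAt (Ici_mem_nhds hs.1)
  deriv_v := fun s hs => by
    rw [pull_div hs.1]
    simpa using h.deriv_v s hs.1

/-- The shot with a given initial slope is unique. -/
theorem IsShot.eq_prof {a : ℝ} {u v : ℝ → ℝ} (h : IsShot a u v) {s : ℝ} (hs : 0 ≤ s) :
    u s = a * prim a s ∧ v s = a * prof a s := by
  -- Volterra solutions are continuous on the whole line, so v is extended by a constant. Then u = t
  -- · avg y, and integrating the equation for v puts y in the scope of uniqueness.
  let y : ℝ → ℝ := fun t => v (max t 0)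
  have hy : Continuous y :=
    h.cont_v.comp_continuous (by fun_prop) fun t => le_max_right t 0
  have hyv : ∀ t, 0 ≤ t → y t = v t := fun t ht => by simp only [y, max_eq_left ht]
  have hu : ∀ t, 0 ≤ t → u t = t * avg y t := by
    intro t ht
    rw [mul_avg, intervalIntegral.integral_eq_sub_of_hasDerivAt_of_le ht (f := u), h.u_zero, sub_zero]
    · exact fun x hx => (h.deriv_u x hx.1).continuousWithinAt.mono fun _ hx => hx.1
    · intro x hx
      rw [hyv x hx.1.le]
      exact (h.deriv_u x hx.1.le).hasDerivAt (Ici_mem_nhds hx.1)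
    · exact hy.intervalIntegrable _ _
  have hV : IsVolterra a (fun _ ρ => pull 1 ρ) y := by
    refine ⟨hy, fun t ht => ?_⟩
    have := intervalIntegral.integral_eq_sub_of_hasDerivAt_of_le ht (f := v)
      (f' := fun x => -pull 1 (avg y x)) (h.cont_v.mono fun _ hx => hx.1) (fun x hx => ?_)
      ((continuous_comp_avg (continuous_pull_const 1) hy).neg.intervalIntegrable _ _)
    · rw [intervalIntegral.integral_neg, h.v_zero] at this
      rw [hyv t ht]; linarith
    · have h2 := (h.isBranch t).deriv_v x hx
      rwa [hu x hx.1.le, mul_div_cancel_left₀ _ hx.1.ne'] at h2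
  have key : ∀ t, 0 ≤ t → y t = a * prof a t := fun t ht =>
    hV.eqOn (isVolterra_mul_prof a) (continuous_pull_const 1) (fun _ => abs_pull_sub_le 1) ht
  refine ⟨?_, by rw [← key s hs, hyv s hs]⟩
  rw [hu s hs, avg_congr hs (fun x hx => key x hx.1), avg_const_mul, prim]
  ring

/-! ### The phase-plane angle. -/

/-- The angular velocity of `(prof, prim)` in the phase plane. -/
noncomputable def angleRate (a t : ℝ) : ℝ :=
  (prof a t ^ 2 + prim a t * pull a (avg (prof a) t)) / (prim a t ^ 2 + prof a t ^ 2)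

theorem continuous_angleRate : Continuous fun p : ℝ × ℝ => angleRate p.1 p.2 := by
  unfold angleRate
  have h1 := continuous_prof
  have h2 := continuous_prim
  have h3 : Continuous fun p : ℝ × ℝ => pull p.1 (avg (prof p.1) p.2) :=
    continuous_pull.comp (f := fun p : ℝ × ℝ => (p.1, avg (prof p.1) p.2))
      (continuous_fst.prodMk continuous_avg_prof)
  exact (by fun_prop : Continuous fun p : ℝ × ℝ =>
    prof p.1 p.2 ^ 2 + prim p.1 p.2 * pull p.1 (avg (prof p.1) p.2)).div (by fun_prop)
    fun p => (sq_add_sq_pos p.1 p.2).ne'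

/-- As `prim` is t times the average, it has the sign of the force, so both terms of the numerator
are nonnegative. They cannot vanish together, since `prof` and `prim` do not. -/
theorem angleRate_pos (a : ℝ) {t : ℝ} (ht : 0 < t) : 0 < angleRate a t := by
  have h := sq_add_sq_pos a t
  refine div_pos ?_ h
  have e : prim a t * pull a (avg (prof a) t) = t * avg (prof a) t ^ 2 * invHyp (a * avg (prof a) t) := by
    rw [prim, pull]; ring
  have hq := invHyp_pos (a * avg (prof a) t)
  rw [e]
  rcases eq_or_ne (prof a t) 0 with h0 | h0
  · have : avg (prof a) t ≠ 0 := by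
      intro h1
      simp [h0, prim, h1] at h
    positivity
  · positivity

/-- The phase-plane angle of `(prof, prim)`. -/
noncomputable def angle (a s : ℝ) : ℝ := ∫ t in (0 : ℝ)..s, angleRate a t

theorem continuous_angle : Continuous fun p : ℝ × ℝ => angle p.1 p.2 :=
  intervalIntegral.continuous_parametric_primitive_of_continuous (f := angleRate)
    continuous_angleRate

theorem angle_zero (a : ℝ) : angle a 0 = 0 := by simp [angle]

theorem hasDerivAt_angle (a s : ℝ) : HasDerivAt (angle a) (angleRate a s) s := by
  have hc : Continuous fun t => angleRate a t :=
    continuous_angleRate.comp (f := fun t => (a, t)) (by fun_prop)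
  exact intervalIntegral.integral_hasDerivAt_right (hc.intervalIntegrable _ _)
    hc.stronglyMeasurable.stronglyMeasurableAtFilter hc.continuousAt

theorem strictMonoOn_angle (a : ℝ) : StrictMonoOn (angle a) (Ici 0) := by
  apply strictMonoOn_of_hasDerivWithinAt_pos (convex_Ici 0)
    (fun s _ => (hasDerivAt_angle a s).continuousAt.continuousWithinAt)
    (f' := angleRate a) (fun s _ => (hasDerivAt_angle a s).hasDerivWithinAt)
  intro s hs
  rw [interior_Ici] at hs
  exact angleRate_pos a hs

theorem angle_pos (a : ℝ) {s : ℝ} (hs : 0 < s) : 0 < angle a s := by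
  rw [← angle_zero a]
  exact strictMonoOn_angle a self_mem_Ici hs.le hs

theorem eq_of_hasDerivAt_zero {f : ℝ → ℝ} {a b : ℝ} (hab : a ≤ b) (hf : ContinuousOn f (Icc a b))
    (hf' : ∀ x ∈ Ioo a b, HasDerivAt f 0 x) : f b = f a := by
  rcases hab.eq_or_lt with rfl | hab
  · rfl
  obtain ⟨c, _, hc⟩ := exists_hasDerivAt_eq_slope f (fun _ => 0) hab hf hf'
  have : b - a ≠ 0 := by linarith
  field_simp at hc
  linarith

/-- Polar coordinates in the phase plane. -/
theorem exists_polar (a : ℝ) {s : ℝ} (hs : 0 ≤ s) :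
    ∃ c > 0, prof a s = c * Real.cos (angle a s) ∧ prim a s = c * Real.sin (angle a s) := by
  -- C and D are the coordinates of (`prof`, `prim`) in the frame rotated by the angle. The quotient
  -- D²/(C² + D²) is the squared sine of the discrepancy between `angle` and the true argument; its
  -- derivative is zero, and it starts at 0.
  let C : ℝ → ℝ := fun t => prof a t * Real.cos (angle a t) + prim a t * Real.sin (angle a t)
  let D : ℝ → ℝ := fun t => prim a t * Real.cos (angle a t) - prof a t * Real.sin (angle a t)
  have hy : Continuous (prof a) := (prof_spec a).cont
  have hU : Continuous (prim a) := continuous_iff_continuousAt.2 fun t => (hasDerivAt_prim a t).continuousAt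
  have hθ : Continuous (angle a) := continuous_iff_continuousAt.2 fun t => (hasDerivAt_angle a t).continuousAt
  have hN : ∀ t, C t ^ 2 + D t ^ 2 = prim a t ^ 2 + prof a t ^ 2 := fun t => by
    have := Real.sin_sq_add_cos_sq (angle a t)
    simp only [C, D]
    linear_combination (prim a t ^ 2 + prof a t ^ 2) * this
  have hD : ∀ t, 0 ≤ t → D t = 0 := by
    intro t ht
    have key := eq_of_hasDerivAt_zero (f := fun t => D t ^ 2 / (prim a t ^ 2 + prof a t ^ 2)) ht
      (by
        apply ContinuousOn.div
        · exact Continuous.continuousOn (by simp only [D]; fun_prop)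
        · exact Continuous.continuousOn (by fun_prop)
        · exact fun x _ => (sq_add_sq_pos a x).ne') ?_
    · have h0 : D 0 = 0 := by simp [D, prim_zero, angle_zero]
      rw [h0] at key
      simp only [ne_eq, OfNat.ofNat_ne_zero, not_false_eq_true, zero_pow, zero_div, div_eq_zero_iff,
        pow_eq_zero_iff, (sq_add_sq_pos a t).ne', or_false] at key
      exact key
    · intro x hx
      have d1 := hasDerivAt_prim a x
      have d2 := hasDerivAt_prof a hx.1
      have d3 := hasDerivAt_angle a x
      rw [prim_div a hx.1.ne'] at d2
      have dD := (d1.mul d3.cos).sub (d2.mul d3.sin)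
      have hpos := (sq_add_sq_pos a x).ne'
      refine ((dD.pow 2).div ((d1.pow 2).add (d2.pow 2)) hpos).congr_deriv ?_
      simp only [angleRate, Pi.sub_apply, Pi.mul_apply, Pi.pow_apply, Pi.add_apply, Nat.cast_ofNat,
        Nat.add_one_sub_one, pow_one]
      rw [div_eq_zero_iff]
      left
      field_simp
      ring
  have hC : ∀ t, 0 ≤ t → C t ≠ 0 := by
    intro t ht h
    have := hN t
    rw [h, hD t ht] at this
    have := sq_add_sq_pos a t
    simp_all
  have hCc : Continuous C := by simp only [C]; fun_prop
  have hpos : 0 < C s := by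
    by_contra! hneg
    have h0 : C 0 = 1 := by simp [C, prof_zero, prim_zero, angle_zero]
    obtain ⟨t, ht, hCt⟩ := intermediate_value_Icc' hs hCc.continuousOn
      (show (0 : ℝ) ∈ Icc (C s) (C 0) from ⟨hneg, by rw [h0]; exact zero_le_one⟩)
    exact hC t ht.1 hCt
  refine ⟨C s, hpos, ?_, ?_⟩
  · have h1 := Real.sin_sq_add_cos_sq (angle a s)
    have h2 := hD s hs
    simp only [C, D] at *
    linear_combination (-prof a s) * h1 - Real.sin (angle a s) * h2
  · have h1 := Real.sin_sq_add_cos_sq (angle a s)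
    have h2 := hD s hs
    simp only [C, D] at *
    linear_combination (-prim a s) * h1 + Real.cos (angle a s) * h2

/-! ### Oscillation: the angle is unbounded. -/

theorem invHyp_le_of_abs_le {x y : ℝ} (h : |x| ≤ |y|) : invHyp y ≤ invHyp x := by
  unfold invHyp
  have := sq_le_sq.2 h
  gcongr

/-- A solution cannot move away from zero forever. -/
theorem not_forall_pos {a S : ℝ} (hS : 0 ≤ S) {u v : ℝ → ℝ}
    (hu : ∀ s ∈ Ioi S, HasDerivAt u (v s) s)
    (hv : ∀ s ∈ Ioi S, HasDerivAt v (-pull a (u s / s)) s) : ¬ ∀ s ∈ Ioi S, 0 < v s := by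
  intro hpos
  by_cases hcase : ∃ s₁ > S, 0 < u s₁
  · obtain ⟨s₁, hs₁, hu₁⟩ := hcase
    have hs₁0 : 0 < s₁ := hS.trans_lt hs₁
    have hsub : Ici s₁ ⊆ Ioi S := fun x hx => lt_of_lt_of_le hs₁ hx
    have humono : MonotoneOn u (Ici s₁) := by
      apply monotoneOn_of_hasDerivWithinAt_nonneg (convex_Ici s₁) (f' := v)
      · exact fun x hx => (hu x (hsub hx)).continuousAt.continuousWithinAt
      · exact fun x hx => (hu x (hsub (interior_subset hx))).hasDerivWithinAt
      · exact fun x hx => (hpos x (hsub (interior_subset hx))).le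
    have hupos : ∀ s ∈ Ici s₁, u s₁ ≤ u s := fun s hs => humono self_mem_Ici hs hs
    have hvanti : AntitoneOn v (Ici s₁) := by
      apply antitoneOn_of_hasDerivWithinAt_nonpos (convex_Ici s₁) (f' := fun s => -pull a (u s / s))
      · exact fun x hx => (hv x (hsub hx)).continuousAt.continuousWithinAt
      · exact fun x hx => (hv x (hsub (interior_subset hx))).hasDerivWithinAt
      · intro x hx
        have hx' := interior_subset hx
        have hx0 : 0 < x := hs₁0.trans_le hx'
        exact neg_nonpos.2 (pull_pos (div_pos (hu₁.trans_le (hupos x hx')) hx0)).le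
    -- Here u increases and v decreases, so u lies between u(s₁) and a linear function C s. The
    -- force is then at least k/s, and v falls at least like k log s.
    set C := u s₁ / s₁ + v s₁ with hC
    have huC : ∀ s ∈ Ici s₁, u s ≤ C * s := by
      intro s hs
      have hm : AntitoneOn (fun s => u s - v s₁ * s) (Ici s₁) := by
        apply antitoneOn_of_hasDerivWithinAt_nonpos (convex_Ici s₁) (f' := fun s => v s - v s₁)
        · exact fun x hx => ((hu x (hsub hx)).continuousAt.continuousWithinAt).sub
            (by fun_prop)
        · intro x hx
          have := (hu x (hsub (interior_subset hx))).sub ((hasDerivAt_id' x).const_mul (v s₁))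
          exact (this.congr_deriv (by ring)).hasDerivWithinAt
        · exact fun x hx => sub_nonpos.2 (hvanti self_mem_Ici (interior_subset hx) (interior_subset hx))
      have h1 := hm self_mem_Ici hs hs
      have h2 : u s₁ ≤ u s₁ / s₁ * s := by
        rw [div_mul_eq_mul_div, le_div_iff₀ hs₁0]
        exact mul_le_mul_of_nonneg_left hs hu₁.le
      have h3 : 0 < v s₁ := hpos _ hs₁
      simp only at h1
      rw [hC, add_mul]
      nlinarith
    set k := u s₁ * invHyp (a * C) with hk
    have hk0 : 0 < k := mul_pos hu₁ (invHyp_pos _)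
    have hC0 : 0 < C := add_pos (div_pos hu₁ hs₁0) (hpos _ hs₁)
    have hlog : AntitoneOn (fun s => v s + k * Real.log s) (Ici s₁) := by
      apply antitoneOn_of_hasDerivWithinAt_nonpos (convex_Ici s₁)
        (f' := fun s => -pull a (u s / s) + k * s⁻¹)
      · intro x hx
        have hx0 : x ≠ 0 := (hs₁0.trans_le hx).ne'
        exact (((hv x (hsub hx)).add ((Real.hasDerivAt_log hx0).const_mul k)).continuousAt).continuousWithinAt
      · intro x hx
        have hx0 : x ≠ 0 := (hs₁0.trans_le (interior_subset hx)).ne'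
        exact ((hv x (hsub (interior_subset hx))).add
          ((Real.hasDerivAt_log hx0).const_mul k)).hasDerivWithinAt
      · intro x hx
        have hx' := interior_subset hx
        have hx0 : 0 < x := hs₁0.trans_le hx'
        have h1 := hupos x hx'
        have h2 : u x / x ≤ C := by rw [div_le_iff₀ hx0]; exact huC x hx'
        have h3 : 0 < u x / x := div_pos (hu₁.trans_le h1) hx0
        have h4 : invHyp (a * C) ≤ invHyp (a * (u x / x)) := by
          apply invHyp_le_of_abs_le
          rw [abs_mul, abs_mul, abs_of_pos h3, abs_of_pos hC0]
          gcongr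
        have h5 : k * x⁻¹ ≤ pull a (u x / x) := by
          rw [pull, hk, div_eq_mul_inv]
          have := invHyp_pos (a * C)
          calc u s₁ * invHyp (a * C) * x⁻¹ = u s₁ * x⁻¹ * invHyp (a * C) := by ring
            _ ≤ u x * x⁻¹ * invHyp (a * (u x * x⁻¹)) := by
              rw [← div_eq_mul_inv (u x)]
              rw [div_eq_mul_inv]
              rw [div_eq_mul_inv] at h4
              gcongr
        linarith
    have hv₁ := hpos _ hs₁
    -- Chosen so that k log s has grown by exactly v(s₁), which leaves v(s₂) ≤ 0.
    set s₂ := s₁ * Real.exp (v s₁ / k) with hs₂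
    have h12 : s₁ ≤ s₂ := le_mul_of_one_le_right hs₁0.le (Real.one_le_exp (by positivity))
    have h1 := hlog self_mem_Ici (show s₂ ∈ Ici s₁ from h12) h12
    have h2 : Real.log s₂ = Real.log s₁ + v s₁ / k := by
      rw [hs₂, Real.log_mul hs₁0.ne' (Real.exp_pos _).ne', Real.log_exp]
    have h3 := hpos s₂ (hsub h12)
    simp only [h2] at h1
    have h4 : k * (v s₁ / k) = v s₁ := by field_simp
    nlinarith
  · push Not at hcase
    set s₁ := S + 1 with hs₁d
    have hs₁ : S < s₁ := by linarith
    have hsub : Ici s₁ ⊆ Ioi S := fun x hx => lt_of_lt_of_le hs₁ hx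
    have hvmono : MonotoneOn v (Ici s₁) := by
      apply monotoneOn_of_hasDerivWithinAt_nonneg (convex_Ici s₁) (f' := fun s => -pull a (u s / s))
      · exact fun x hx => (hv x (hsub hx)).continuousAt.continuousWithinAt
      · exact fun x hx => (hv x (hsub (interior_subset hx))).hasDerivWithinAt
      · intro x hx
        have hx' := hsub (interior_subset hx)
        have hx0 : 0 < x := hS.trans_lt hx'
        rw [← pull_neg]
        refine mul_nonneg (neg_nonneg.2 ?_) (invHyp_pos _).le
        exact div_nonpos_of_nonpos_of_nonneg (hcase x hx') hx0.le
    have hm : MonotoneOn (fun s => u s - v s₁ * s) (Ici s₁) := by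
      apply monotoneOn_of_hasDerivWithinAt_nonneg (convex_Ici s₁) (f' := fun s => v s - v s₁)
      · exact fun x hx => ((hu x (hsub hx)).continuousAt.continuousWithinAt).sub
          (by fun_prop)
      · intro x hx
        have := (hu x (hsub (interior_subset hx))).sub ((hasDerivAt_id' x).const_mul (v s₁))
        exact (this.congr_deriv (by ring)).hasDerivWithinAt
      · exact fun x hx => sub_nonneg.2 (hvmono self_mem_Ici (interior_subset hx) (interior_subset hx))
    have hv₁ := hpos _ hs₁
    have hu₁ := hcase _ hs₁
    -- While u ≤ 0 the slope v does not decrease, so u grows at least linearly; at this time it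
    -- would have reached 1.
    set s₂ := s₁ + (1 - u s₁) / v s₁ with hs₂
    have h12 : s₁ ≤ s₂ := by
      have : 0 ≤ (1 - u s₁) / v s₁ := div_nonneg (by linarith) hv₁.le
      linarith
    have h1 := hm self_mem_Ici (show s₂ ∈ Ici s₁ from h12) h12
    have h2 := hcase s₂ (hsub h12)
    have h3 : v s₁ * s₂ = v s₁ * s₁ + (1 - u s₁) := by rw [hs₂]; field_simp
    simp only at h1
    linarith

/-- Without zeros beyond S the profile would keep one sign there. The force is odd, so a negative
sign reduces to the positive case excluded by `not_forall_pos`. -/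
theorem exists_prof_eq_zero (a : ℝ) {S : ℝ} (hS : 0 ≤ S) : ∃ s > S, prof a s = 0 := by
  by_contra! hne
  have hsub : ∀ s ∈ Ioi S, 0 < s := fun s hs => hS.trans_lt hs
  have hu : ∀ s ∈ Ioi S, HasDerivAt (prim a) (prof a s) s := fun s _ => hasDerivAt_prim a s
  have hv : ∀ s ∈ Ioi S, HasDerivAt (prof a) (-pull a (prim a s / s)) s :=
    fun s hs => hasDerivAt_prof a (hsub s hs)
  have hcont := (prof_spec a).cont
  have hconst : (∀ s ∈ Ioi S, 0 < prof a s) ∨ ∀ s ∈ Ioi S, prof a s < 0 := by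
    by_contra! hcon
    obtain ⟨⟨x, hx, hx0⟩, ⟨y, hy, hy0⟩⟩ := hcon
    obtain ⟨z, hz, hz0⟩ := isPreconnected_Ioi.intermediate_value hx hy hcont.continuousOn ⟨hx0, hy0⟩
    exact hne z hz hz0
  rcases hconst with h | h
  · exact not_forall_pos hS hu hv h
  · refine not_forall_pos (a := a) hS (u := fun s => -prim a s) (v := fun s => -prof a s)
      (fun s hs => (hu s hs).neg) (fun s hs => ?_) (fun s hs => neg_pos.2 (h s hs))
    have := (hv s hs).neg
    rwa [neg_div, pull_neg]

theorem prof_eq_zero_iff (a : ℝ) {s : ℝ} (hs : 0 < s) :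
    prof a s = 0 ↔ ∃ n : ℕ, angle a s = (n + 1 / 2) * Real.pi := by
  obtain ⟨c, hc, h1, _⟩ := exists_polar a hs.le
  have hpi := Real.pi_pos
  rw [h1, mul_eq_zero, or_iff_right hc.ne', Real.cos_eq_zero_iff]
  constructor
  · rintro ⟨k, hk⟩
    have h0 := angle_pos a hs
    have hk0 : 0 ≤ k := by
      by_contra! hneg
      have : (k : ℝ) ≤ -1 := by exact_mod_cast Int.le_sub_one_of_lt hneg
      rw [hk] at h0
      nlinarith
    lift k to ℕ using hk0
    exact ⟨k, by rw [hk]; push_cast; ring⟩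
  · rintro ⟨n, hn⟩
    exact ⟨n, by rw [hn]; push_cast; ring⟩

theorem exists_angle_eq {a S M : ℝ} (hS : 0 ≤ S) (h0 : 0 ≤ M) (h : M ≤ angle a S) :
    ∃ s, 0 ≤ s ∧ angle a s = M := by
  have hθ : Continuous (angle a) := continuous_iff_continuousAt.2 fun t => (hasDerivAt_angle a t).continuousAt
  obtain ⟨s, hs, h1⟩ := intermediate_value_Icc hS hθ.continuousOn
    (show M ∈ Icc (angle a 0) (angle a S) from ⟨by rwa [angle_zero], h⟩)
  exact ⟨s, hs.1, h1⟩

/-- Every zero of the profile lies at an angle (k + 1/2)π and the angle increases strictly, so each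
later zero costs a further π. -/
theorem exists_le_angle (a : ℝ) (n : ℕ) : ∃ s, 0 < s ∧ (n + 1 / 2) * Real.pi ≤ angle a s := by
  have hpi := Real.pi_pos
  induction n with
  | zero =>
    obtain ⟨s, hs, h0⟩ := exists_prof_eq_zero a (le_refl 0)
    obtain ⟨k, hk⟩ := (prof_eq_zero_iff a hs).1 h0
    refine ⟨s, hs, ?_⟩
    rw [hk]
    have : (0 : ℝ) ≤ k := Nat.cast_nonneg k
    push_cast
    nlinarith
  | succ n ih =>
    obtain ⟨t, ht, hle⟩ := ih
    obtain ⟨s, hs, h0⟩ := exists_prof_eq_zero a ht.le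
    have hs0 : 0 < s := ht.trans hs
    obtain ⟨k, hk⟩ := (prof_eq_zero_iff a hs0).1 h0
    refine ⟨s, hs0, ?_⟩
    have h1 := strictMonoOn_angle a ht.le hs0.le hs
    rw [hk] at h1 ⊢
    have h2 : (n : ℝ) < k := by
      have := lt_of_mul_lt_mul_right (hle.trans_lt h1) hpi.le
      linarith
    have h3 : ((n + 1 : ℕ) : ℝ) ≤ k := by exact_mod_cast h2
    gcongr

theorem exists_angle_eq_of_nonneg (a : ℝ) {M : ℝ} (h0 : 0 ≤ M) : ∃ s, 0 ≤ s ∧ angle a s = M := by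
  obtain ⟨n, hn⟩ := exists_nat_gt (M / Real.pi)
  obtain ⟨s, hs, hle⟩ := exists_le_angle a n
  refine exists_angle_eq hs.le h0 (le_trans ?_ hle)
  have hpi := Real.pi_pos
  rw [div_lt_iff₀ hpi] at hn
  nlinarith

/-! ### The zeros of the profile and their number. -/

/-- The time at which the phase-plane angle takes the value `M`. -/
noncomputable def timeOf (M a : ℝ) : ℝ :=
  if h : 0 ≤ M then (exists_angle_eq_of_nonneg a h).choose else 0

theorem timeOf_nonneg (M a : ℝ) : 0 ≤ timeOf M a := by
  unfold timeOf
  split_ifs with h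
  · exact (exists_angle_eq_of_nonneg a h).choose_spec.1
  · exact le_rfl

theorem angle_timeOf {M : ℝ} (hM : 0 ≤ M) (a : ℝ) : angle a (timeOf M a) = M := by
  unfold timeOf
  rw [dif_pos hM]
  exact (exists_angle_eq_of_nonneg a hM).choose_spec.2

theorem lt_timeOf_iff {M : ℝ} (hM : 0 ≤ M) (a : ℝ) {s : ℝ} (hs : 0 ≤ s) :
    s < timeOf M a ↔ angle a s < M := by
  rw [← (strictMonoOn_angle a).lt_iff_lt hs (timeOf_nonneg M a), angle_timeOf hM]

theorem timeOf_lt_iff {M : ℝ} (hM : 0 ≤ M) (a : ℝ) {s : ℝ} (hs : 0 ≤ s) :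
    timeOf M a < s ↔ M < angle a s := by
  rw [← (strictMonoOn_angle a).lt_iff_lt (timeOf_nonneg M a) hs, angle_timeOf hM]

theorem eq_timeOf_iff {M : ℝ} (hM : 0 ≤ M) (a : ℝ) {s : ℝ} (hs : 0 ≤ s) :
    s = timeOf M a ↔ angle a s = M := by
  rw [← (strictMonoOn_angle a).injOn.eq_iff hs (timeOf_nonneg M a), angle_timeOf hM]

theorem timeOf_zero (a : ℝ) : timeOf 0 a = 0 :=
  ((eq_timeOf_iff le_rfl a le_rfl).2 (angle_zero a)).symm

theorem timeOf_pos {M : ℝ} (hM : 0 < M) (a : ℝ) : 0 < timeOf M a :=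
  (lt_timeOf_iff hM.le a le_rfl).2 (by rwa [angle_zero])

theorem timeOf_lt_timeOf {M M' : ℝ} (hM : 0 ≤ M) (h : M < M') (a : ℝ) :
    timeOf M a < timeOf M' a := by
  rwa [lt_timeOf_iff (hM.trans h.le) a (timeOf_nonneg _ _), angle_timeOf hM]

/-- Strict monotonicity of the angle turns l < timeOf and timeOf < l into strict inequalities
between `angle a l` and M, which are open conditions on a. -/
theorem continuous_timeOf {M : ℝ} (hM : 0 < M) : Continuous (timeOf M) := by
  have hθ : ∀ s, Continuous fun a => angle a s := fun s =>
    continuous_angle.comp (f := fun a => (a, s)) (by fun_prop)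
  rw [continuous_iff_continuousAt]
  intro a
  refine tendsto_order.2 ⟨fun l hl => ?_, fun l hl => ?_⟩
  · rcases lt_or_ge l 0 with h | h
    · exact Eventually.of_forall fun b => h.trans_le (timeOf_nonneg M b)
    · filter_upwards [(hθ l).continuousAt.eventually (gt_mem_nhds ((lt_timeOf_iff hM.le a h).1 hl))]
        with b hb using (lt_timeOf_iff hM.le b h).2 hb
  · have h : 0 ≤ l := (timeOf_nonneg M a).trans hl.le
    filter_upwards [(hθ l).continuousAt.eventually (lt_mem_nhds ((timeOf_lt_iff hM.le a h).1 hl))]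
        with b hb using (timeOf_lt_iff hM.le b h).2 hb

/-- The `n`-th positive zero of the profile, counted from `n = 0`. -/
noncomputable def tau (n : ℕ) (a : ℝ) : ℝ := timeOf ((n + 1 / 2) * Real.pi) a

theorem tau_level_pos (n : ℕ) : 0 < ((n : ℝ) + 1 / 2) * Real.pi := by
  have := Real.pi_pos
  positivity

theorem tau_pos (n : ℕ) (a : ℝ) : 0 < tau n a := timeOf_pos (tau_level_pos n) a

theorem continuous_tau (n : ℕ) : Continuous (tau n) := continuous_timeOf (tau_level_pos n)

theorem strictMono_tau (a : ℝ) : StrictMono fun n => tau n a := by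
  intro m n hmn
  have : (m : ℝ) < n := by exact_mod_cast hmn
  have := Real.pi_pos
  exact timeOf_lt_timeOf (tau_level_pos m).le (by gcongr) a

theorem prof_eq_zero_iff_tau (a : ℝ) {s : ℝ} (hs : 0 < s) :
    prof a s = 0 ↔ ∃ n : ℕ, tau n a = s := by
  rw [prof_eq_zero_iff a hs]
  refine exists_congr fun n => ?_
  rw [← eq_timeOf_iff (tau_level_pos n).le a hs.le, eq_comm, tau]

theorem prof_tau (n : ℕ) (a : ℝ) : prof a (tau n a) = 0 :=
  (prof_eq_zero_iff_tau a (tau_pos n a)).2 ⟨n, rfl⟩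

theorem zeros_eq_image (a z : ℝ) :
    {x ∈ Ioo 0 z | prof a x = 0} = (fun n => tau n a) '' {n | tau n a < z} := by
  ext x
  constructor
  · rintro ⟨⟨h0, hz⟩, hx⟩
    obtain ⟨n, rfl⟩ := (prof_eq_zero_iff_tau a h0).1 hx
    exact ⟨n, hz, rfl⟩
  · rintro ⟨n, hn, rfl⟩
    exact ⟨⟨tau_pos n a, hn⟩, prof_tau n a⟩

/-- The zeros in (0, z) are an initial segment of the sequence `tau`, counted from 0; there are more
than n of them precisely when `tau n a` is one. -/
theorem encard_zeros_le_iff (a z : ℝ) (n : ℕ) :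
    {x ∈ Ioo 0 z | prof a x = 0}.encard ≤ n ↔ z ≤ tau n a := by
  rw [zeros_eq_image, (strictMono_tau a).injective.encard_image]
  constructor
  · intro h
    by_contra! hlt
    have hsub : Iic n ⊆ {m | tau m a < z} := fun m hm =>
      lt_of_le_of_lt ((strictMono_tau a).monotone hm) hlt
    have h1 := (encard_le_encard hsub).trans h
    have h2 : (Iic n).encard = ((n + 1 : ℕ) : ℕ∞) := by
      rw [← Finset.coe_Iic, encard_coe_eq_coe_finsetCard, Nat.card_Iic]
    rw [h2] at h1
    have : n + 1 ≤ n := by exact_mod_cast h1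
    omega
  · intro h
    have hsub : {m | tau m a < z} ⊆ Iio n := fun m hm =>
      (strictMono_tau a).lt_iff_lt.1 (lt_of_lt_of_le hm h)
    have h2 : (Iio n).encard = (n : ℕ∞) := by
      rw [← Finset.coe_Iio, encard_coe_eq_coe_finsetCard, Nat.card_Iio]
    rw [← h2]
    exact encard_le_encard hsub

theorem encard_zeros_tau (a : ℝ) (n : ℕ) :
    {x ∈ Ioo 0 (tau n a) | prof a x = 0}.encard = n := by
  refine le_antisymm ((encard_zeros_le_iff a _ n).2 le_rfl) ?_
  rcases n with - | m
  · simp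
  · by_contra! h
    have h1 : {x ∈ Ioo 0 (tau (m + 1) a) | prof a x = 0}.encard ≤ m := by
      rw [← ENat.lt_add_one_iff (ENat.natCast_ne_top m)]
      simpa using h
    rw [encard_zeros_le_iff] at h1
    exact absurd h1 (not_le.2 (strictMono_tau a (Nat.lt_succ_self m)))

theorem isNthZero_prof_iff (a z : ℝ) (n : ℕ) : IsNthZero (prof a) (n + 1) z ↔ z = tau n a := by
  constructor
  · rintro ⟨h0, hz, hc⟩
    obtain ⟨m, rfl⟩ := (prof_eq_zero_iff_tau a h0).1 hz
    rw [encard_zeros_tau] at hc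
    have : m + 1 = n + 1 := by exact_mod_cast hc
    rw [Nat.succ_injective this]
  · rintro rfl
    exact ⟨tau_pos n a, prof_tau n a, by rw [encard_zeros_tau]; norm_cast⟩

/-! ### Sign of the linearised solution over half-swings. -/

theorem eventually_lt_right_of_hasDerivAt {f : ℝ → ℝ} {d t : ℝ} (h : HasDerivAt f d t) (hd : 0 < d) :
    ∀ᶠ x in 𝓝[>] t, f t < f x := by
  have h1 := (hasDerivAt_iff_tendsto_slope.1 h).eventually (lt_mem_nhds hd)
  have h2 : ∀ᶠ x in 𝓝[>] t, 0 < _root_.slope f t x :=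
    h1.filter_mono (nhdsWithin_mono _ fun x (hx : t < x) => hx.ne')
  filter_upwards [h2, self_mem_nhdsWithin] with x hx (hlt : t < x)
  rw [slope_def_field, div_pos_iff_of_pos_right (sub_pos.2 hlt)] at hx
  linarith

theorem eventually_lt_left_of_hasDerivAt {f : ℝ → ℝ} {d t : ℝ} (h : HasDerivAt f d t) (hd : 0 < d) :
    ∀ᶠ x in 𝓝[<] t, f x < f t := by
  have h1 := (hasDerivAt_iff_tendsto_slope.1 h).eventually (lt_mem_nhds hd)
  have h2 : ∀ᶠ x in 𝓝[<] t, 0 < _root_.slope f t x :=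
    h1.filter_mono (nhdsWithin_mono _ fun x (hx : x < t) => hx.ne)
  filter_upwards [h2, self_mem_nhdsWithin] with x hx (hlt : x < t)
  rw [slope_def_field] at hx
  have := (div_pos_iff.1 hx).resolve_left fun h => by linarith [h.2]
  linarith [this.1]

theorem exists_first_zero {f : ℝ → ℝ} {a b : ℝ} (hab : a ≤ b) (hf : ContinuousOn f (Icc a b))
    (ha : f a < 0) (hb : 0 ≤ f b) : ∃ t ∈ Ioc a b, f t = 0 ∧ ∀ x ∈ Ico a t, f x < 0 := by
  have hc : IsCompact (Icc a b ∩ f ⁻¹' Ici 0) :=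
    isCompact_Icc.of_isClosed_subset (hf.preimage_isClosed_of_isClosed isClosed_Icc isClosed_Ici)
      inter_subset_left
  obtain ⟨t, ⟨ht, ht0⟩, hleast⟩ := hc.exists_isLeast ⟨b, right_mem_Icc.2 hab, hb⟩
  have hneg : ∀ x ∈ Ico a t, f x < 0 := by
    intro x hx
    by_contra! h
    exact absurd (hleast ⟨⟨hx.1, hx.2.le.trans ht.2⟩, h⟩) (not_le.2 hx.2)
  have hat : a < t := by
    rcases ht.1.eq_or_lt with h | h
    · rw [← h] at ht0
      exact absurd ha (not_lt.2 ht0)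
    · exact h
  refine ⟨t, ⟨hat, ht.2⟩, ?_, hneg⟩
  obtain ⟨c, hc, hc0⟩ := intermediate_value_Icc hat.le (hf.mono (Icc_subset_Icc_right ht.2))
    (show (0 : ℝ) ∈ Icc (f a) (f t) from ⟨ha.le, ht0⟩)
  rcases hc.2.eq_or_lt with h | h
  · rwa [← h]
  · exact absurd hc0 (hneg c ⟨hc.1, h⟩).ne

/-- The function is positive just after a, so failure of positivity would produce a first return to
zero; only first returns need to be excluded by `hno`. -/
theorem pos_of_no_return {f : ℝ → ℝ} {a b d : ℝ} (hf : ContinuousOn f (Icc a b)) (ha : f a = 0)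
    (hd : HasDerivAt f d a) (hd0 : 0 < d)
    (hno : ∀ t ∈ Ioc a b, (∀ x ∈ Ioo a t, 0 < f x) → f t ≠ 0) : ∀ t ∈ Ioc a b, 0 < f t := by
  intro t ht
  by_contra! hneg
  obtain ⟨c, hac, hc⟩ := mem_nhdsGT_iff_exists_Ioo_subset.1 (eventually_lt_right_of_hasDerivAt hd hd0)
  rw [mem_Ioi] at hac
  have hpos : ∀ x ∈ Ioo a c, 0 < f x := fun x hx => by
    have := hc hx
    rw [mem_ofPred_eq, ha] at this
    exact this
  set e := (a + min c t) / 2 with he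
  have hm : a < min c t := lt_min hac ht.1
  have hae : a < e := by rw [he]; linarith
  have hec : e < c := by rw [he]; linarith [min_le_left c t]
  have het : e < t := by rw [he]; linarith [min_le_right c t]
  obtain ⟨x, hx, hx0, hlt⟩ := exists_first_zero (f := fun x => -f x) het.le
    ((hf.mono (Icc_subset_Icc hae.le ht.2)).neg) (neg_neg_of_pos (hpos e ⟨hae, hec⟩))
    (neg_nonneg.2 hneg)
  refine hno x ⟨hae.trans hx.1, hx.2.trans ht.2⟩ (fun y hy => ?_) (neg_eq_zero.1 hx0)
  rcases lt_or_ge y e with h | h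
  · exact hpos y ⟨hy.1, h.trans hec⟩
  · exact neg_lt_zero.1 (hlt y ⟨h, hy.2⟩)

theorem nonpos_of_hasDerivAt_of_pos_left {f : ℝ → ℝ} {a t d : ℝ} (hat : a < t)
    (hd : HasDerivAt f d t) (hpos : ∀ x ∈ Ioo a t, 0 < f x) (h0 : f t = 0) : d ≤ 0 := by
  by_contra! h
  obtain ⟨x, hx, hx'⟩ := ((eventually_lt_left_of_hasDerivAt hd h).and (Ioo_mem_nhdsLT hat)).exists
  rw [h0] at hx
  exact absurd hx (not_lt.2 (hpos x hx').le)

/-- `(u, v)` solves the shape equation on `(0, ∞)`, and `(w, o)` its linearisation at `(u, v)`. -/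
structure IsVariation (u v w o : ℝ → ℝ) : Prop where
  deriv_u : ∀ s, 0 < s → HasDerivAt u (v s) s
  deriv_v : ∀ s, 0 < s → HasDerivAt v (-pull 1 (u s / s)) s
  deriv_w : ∀ s, 0 < s → HasDerivAt w (o s) s
  deriv_o : ∀ s, 0 < s → HasDerivAt o (-(invHyp (u s / s) ^ 3 * (w s / s))) s

/-- The weighted Wronskian of `w` and `(u - s v) / √s`. -/
noncomputable def radialWronskian (u v w o : ℝ → ℝ) (s : ℝ) : ℝ :=
  (w s * s * pull 1 (u s / s) - w s * (u s - s * v s) / (2 * s) - o s * (u s - s * v s)) / √s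

namespace IsVariation

variable {u v w o : ℝ → ℝ}

theorem neg (h : IsVariation u v w o) : IsVariation (-u) (-v) (-w) (-o) where
  deriv_u := fun s hs => (h.deriv_u s hs).neg
  deriv_v := fun s hs => by
    have := (h.deriv_v s hs).neg
    simpa [neg_div, pull_neg] using this
  deriv_w := fun s hs => (h.deriv_w s hs).neg
  deriv_o := fun s hs => by
    have := (h.deriv_o s hs).neg
    refine this.congr_deriv ?_
    simp [neg_div, invHyp]

theorem radialWronskian_neg (s : ℝ) :
    radialWronskian (-u) (-v) (-w) (-o) s = radialWronskian u v w o s := by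
  simp only [radialWronskian, Pi.neg_apply, neg_div, pull_neg]
  ring

theorem hasDerivAt_sub (h : IsVariation u v w o) {s : ℝ} (hs : 0 < s) :
    HasDerivAt (fun s => u s - s * v s) (s * pull 1 (u s / s)) s := by
  refine ((h.deriv_u s hs).sub ((hasDerivAt_id' s).mul (h.deriv_v s hs))).congr_deriv ?_
  ring

/-- With r = u/s, the solution u misses the linearised equation by pull 1 r - invHyp(r)³ r = r³
invHyp(r)³, which has the sign of u. -/
theorem hasDerivAt_wronskian (h : IsVariation u v w o) {s : ℝ} (hs : 0 < s) :
    HasDerivAt (fun s => w s * v s - o s * u s)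
      (-(w s * (u s / s) ^ 3 * invHyp (u s / s) ^ 3)) s := by
  refine (((h.deriv_w s hs).mul (h.deriv_v s hs)).sub
    ((h.deriv_o s hs).mul (h.deriv_u s hs))).congr_deriv ?_
  have h1 := invHyp_sq (u s / s)
  have h2 : w s / s * u s = w s * (u s / s) := by ring
  rw [pull, one_mul]
  linear_combination (invHyp (u s / s) ^ 3) * h2 + (w s * (u s / s) * invHyp (u s / s)) * h1

/-- Let z = u - s v, F the force and q its derivative. From z' = s F follows z'' + (q/s) z = F.
Passing to y = z/√s cancels F and leaves y'' + (q/s) y = (3/4) y/s², while w'' + (q/s) w = 0. This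
explains the weight √s and the factor 3/4. -/
theorem hasDerivAt_radialWronskian (h : IsVariation u v w o) {s : ℝ} (hs : 0 < s) :
    HasDerivAt (radialWronskian u v w o) (3 / 4 * (w s * (u s - s * v s)) / (s ^ 2 * √s)) s := by
  have hr : HasDerivAt (fun s => u s / s) ((v s * s - u s * 1) / s ^ 2) s :=
    (h.deriv_u s hs).div (hasDerivAt_id' s) hs.ne'
  have hF : HasDerivAt (fun s => pull 1 (u s / s))
      (invHyp (u s / s) ^ 3 * ((v s * s - u s * 1) / s ^ 2)) s := by
    have := HasDerivAt.comp (h := fun s => u s / s) s (hasDerivAt_pull 1 (u s / s)) hr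
    rwa [one_mul] at this
  have hz := h.hasDerivAt_sub hs
  have hw := h.deriv_w s hs
  have ho := h.deriv_o s hs
  have h2s : HasDerivAt (fun s : ℝ => 2 * s) 2 s := by
    simpa using (hasDerivAt_id' s).const_mul (2 : ℝ)
  have hN := (((hw.mul (hasDerivAt_id' s)).mul hF).sub ((hw.mul hz).div h2s (by positivity))).sub
    (ho.mul hz)
  have hsq : 0 < √s := Real.sqrt_pos.2 hs
  have hK := hN.div (Real.hasDerivAt_sqrt hs.ne') hsq.ne'
  refine hK.congr_deriv ?_
  have hss : √s ^ 2 = s := Real.sq_sqrt hs.le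
  simp only [Pi.mul_apply, Pi.sub_apply, Pi.div_apply]
  generalize invHyp (u s / s) ^ 3 = q
  generalize pull 1 (u s / s) = F
  generalize √s = x at hss hsq
  subst hss
  field_simp
  ring

theorem continuousOn_radialWronskian (h : IsVariation u v w o) {a b : ℝ} (ha : 0 < a) :
    ContinuousOn (radialWronskian u v w o) (Icc a b) := fun _ hs =>
  (h.hasDerivAt_radialWronskian (ha.trans_le hs.1)).continuousAt.continuousWithinAt

theorem monotoneOn_radialWronskian (h : IsVariation u v w o) {a b : ℝ} (ha : 0 < a)
    (hpos : ∀ s ∈ Ioo a b, 0 ≤ w s * (u s - s * v s)) :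
    MonotoneOn (radialWronskian u v w o) (Icc a b) := by
  apply monotoneOn_of_hasDerivWithinAt_nonneg (convex_Icc a b) (h.continuousOn_radialWronskian ha)
    (f' := fun s => 3 / 4 * (w s * (u s - s * v s)) / (s ^ 2 * √s))
  · intro s hs
    rw [interior_Icc] at hs
    exact (h.hasDerivAt_radialWronskian (ha.trans hs.1)).hasDerivWithinAt
  · intro s hs
    rw [interior_Icc] at hs
    have := hpos s hs
    positivity

/-- While w > 0 and u > 0, the Wronskian w v - o u decreases from -o(t) u(t) ≤ 0. At a first return
of w to 0 its negativity would force o > 0, whereas w arrives from above with o ≤ 0. -/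
theorem pos_after (h : IsVariation u v w o) {t β : ℝ} (ht : 0 ≤ t)
    (hcont : ContinuousOn (fun s => w s * v s - o s * u s) (Icc t β))
    (hwcont : ContinuousOn w (Icc t β)) (hw : w t = 0) (hdw : HasDerivAt w (o t) t) (ho : 0 < o t)
    (hu : ∀ s ∈ Ioo t β, 0 < u s) (huβ : 0 ≤ u β) (hut : 0 ≤ u t) :
    ∀ s ∈ Ioc t β, 0 < w s ∧ w s * v s - o s * u s < 0 := by
  have hanti : ∀ x ∈ Ioc t β, (∀ y ∈ Ioo t x, 0 < w y) → w x * v x - o x * u x < 0 := by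
    intro x hx hy
    have hP : StrictAntiOn (fun s => w s * v s - o s * u s) (Icc t x) := by
      apply strictAntiOn_of_hasDerivWithinAt_neg (convex_Icc t x)
        (hcont.mono (Icc_subset_Icc_right hx.2))
        (f' := fun s => -(w s * (u s / s) ^ 3 * invHyp (u s / s) ^ 3))
      · intro s hs
        rw [interior_Icc] at hs
        exact (h.hasDerivAt_wronskian (ht.trans_lt hs.1)).hasDerivWithinAt
      · intro s hs
        rw [interior_Icc] at hs
        have h1 := hy s hs
        have h2 := hu s ⟨hs.1, hs.2.trans_le hx.2⟩
        have h3 := invHyp_pos (u s / s)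
        have h4 : 0 < s := ht.trans_lt hs.1
        exact neg_neg_of_pos (by positivity)
    have h1 := hP (left_mem_Icc.2 hx.1.le) (right_mem_Icc.2 hx.1.le) hx.1
    simp only [hw, zero_mul, zero_sub] at h1
    have h2 : 0 ≤ o t * u t := mul_nonneg ho.le hut
    linarith
  have hpos := pos_of_no_return hwcont hw hdw ho (fun x hx hy h0 => by
    have h1 := hanti x hx hy
    have h2 := nonpos_of_hasDerivAt_of_pos_left hx.1 (h.deriv_w x (ht.trans_lt hx.1)) hy h0
    have h3 : 0 ≤ u x := by
      rcases hx.2.eq_or_lt with h | h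
      · rwa [h]
      · exact (hu x ⟨hx.1, h⟩).le
    rw [h0] at h1
    nlinarith)
  exact fun s hs => ⟨hpos s hs, hanti s hs fun y hy => hpos y ⟨hy.1, hy.2.le.trans hs.2⟩⟩

theorem strictMonoOn_sub (h : IsVariation u v w o) {α β : ℝ} (hα : 0 ≤ α)
    (hcont : ContinuousOn (fun s => u s - s * v s) (Icc α β))
    (hu : ∀ s ∈ Ioo α β, 0 < u s) : StrictMonoOn (fun s => u s - s * v s) (Icc α β) := by
  apply strictMonoOn_of_hasDerivWithinAt_pos (convex_Icc α β) hcont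
    (f' := fun s => s * pull 1 (u s / s))
  · intro s hs
    rw [interior_Icc] at hs
    exact (h.hasDerivAt_sub (hα.trans_lt hs.1)).hasDerivWithinAt
  · intro s hs
    rw [interior_Icc] at hs
    have h0 : 0 < s := hα.trans_lt hs.1
    exact mul_pos h0 (pull_pos (div_pos (hu s hs) h0))

/-- The relative position of `w` and `u` is preserved over a half-swing. -/
theorem half_swing (h : IsVariation u v w o) {α β : ℝ} (hα : 0 < α) (hαβ : α < β)
    (huα : u α = 0) (huβ : u β = 0) (hu : ∀ s ∈ Ioo α β, 0 < u s) (hvα : 0 < v α) (hvβ : v β < 0)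
    (hw : w α < 0) (hK : 0 < radialWronskian u v w o α) :
    0 < w β ∧ 0 < radialWronskian u v w o β ∧ ∀ s ∈ Ioo α β, v s = 0 → 0 < o s := by
  have hcw : ∀ s, 0 < s → ContinuousAt w s := fun s hs => (h.deriv_w s hs).continuousAt
  have hβ : 0 < β := hα.trans hαβ
  have hzcont : ContinuousOn (fun s => u s - s * v s) (Icc α β) := fun s hs =>
    (h.hasDerivAt_sub (hα.trans_le hs.1)).continuousAt.continuousWithinAt
  have hzmono := h.strictMonoOn_sub hα.le hzcont hu
  -- The function u - s v increases from a negative to a positive value; its zero ζ splits the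
  -- half-swing. Before ζ, w < 0 makes the radial Wronskian nondecreasing; after ζ, w > 0 does.
  obtain ⟨ζ, hζ, hζ0⟩ := intermediate_value_Ioo hαβ.le hzcont
    (show (0 : ℝ) ∈ Ioo (u α - α * v α) (u β - β * v β) from
      ⟨by rw [huα]; nlinarith, by rw [huβ]; nlinarith⟩)
  simp only at hζ0
  have hζpos : 0 < ζ := hα.trans hζ.1
  have hzneg : ∀ s ∈ Ico α ζ, u s - s * v s < 0 := fun s hs => by
    have := hzmono ⟨hs.1, hs.2.le.trans hζ.2.le⟩ ⟨hζ.1.le, hζ.2.le⟩ hs.2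
    simp only at this
    linarith
  have hzpos : ∀ s ∈ Ioc ζ β, 0 < u s - s * v s := fun s hs => by
    have := hzmono ⟨hζ.1.le, hζ.2.le⟩ ⟨hζ.1.le.trans hs.1.le, hs.2⟩ hs.1
    simp only at this
    linarith
  have hKζ : radialWronskian u v w o ζ = w ζ * ζ * pull 1 (u ζ / ζ) / √ζ := by
    rw [radialWronskian, hζ0]; ring
  have hKmono : ∀ t ∈ Icc α ζ, (∀ s ∈ Ioo α t, w s < 0) → 0 < radialWronskian u v w o t := by
    intro t ht hneg
    refine hK.trans_le (h.monotoneOn_radialWronskian hα (fun s hs => ?_) (left_mem_Icc.2 ht.1)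
      (right_mem_Icc.2 ht.1) ht.1)
    exact (mul_pos_of_neg_of_neg (hneg s hs) (hzneg s ⟨hs.1.le, hs.2.trans_le ht.2⟩)).le
  have hfac : 0 < ζ * pull 1 (u ζ / ζ) / √ζ := by
    have := pull_pos (κ := 1) (div_pos (hu ζ hζ) hζpos)
    positivity
  -- At ζ the radial Wronskian has the sign of w. Were w negative up to ζ, the Wronskian would be
  -- both positive and negative there.
  have hex : ∃ x ∈ Icc α ζ, 0 ≤ w x := by
    by_contra! hcon
    have h1 := hKmono ζ (right_mem_Icc.2 hζ.1.le) fun s hs => hcon s ⟨hs.1.le, hs.2.le⟩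
    rw [hKζ, mul_assoc, mul_div_assoc] at h1
    exact absurd (pos_of_mul_pos_left h1 hfac.le) (not_lt.2 (hcon ζ (right_mem_Icc.2 hζ.1.le)).le)
  obtain ⟨x, hx, hwx⟩ := hex
  obtain ⟨t, ht, hwt, hneg⟩ := exists_first_zero hx.1
    (fun s hs => (hcw s (hα.trans_le hs.1)).continuousWithinAt) hw hwx
  have htζ : t ≤ ζ := ht.2.trans hx.2
  have ht0 : 0 < t := hα.trans ht.1
  -- At the first zero t of w the radial Wronskian reduces to -o (u - s v)/√t. Its positivity gives
  -- t < ζ and o(t) > 0, so w crosses upwards and `pos_after` applies.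
  have hKt := hKmono t ⟨ht.1.le, htζ⟩ fun s hs => hneg s ⟨hs.1.le, hs.2⟩
  have hKt' : 0 < -(o t * (u t - t * v t)) := by
    rw [radialWronskian, hwt] at hKt
    have := (div_pos_iff_of_pos_right (Real.sqrt_pos.2 ht0)).1 hKt
    simp only [zero_mul, zero_div] at this
    linarith
  have htζ' : t < ζ := by
    rcases htζ.eq_or_lt with e | e
    · rw [e, hζ0] at hKt'
      simp at hKt'
    · exact e
  have hzt := hzneg t ⟨ht.1.le, htζ'⟩
  have hot : 0 < o t := by
    by_contra! hcon
    nlinarith [mul_nonneg_of_nonpos_of_nonpos hcon hzt.le]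
  have htβ : t < β := htζ'.trans hζ.2
  have hafter := h.pos_after ht0.le (β := β)
    (fun s hs => by
      have hs0 := ht0.trans_le hs.1
      exact (h.hasDerivAt_wronskian hs0).continuousAt.continuousWithinAt)
    (fun s hs => (hcw s (ht0.trans_le hs.1)).continuousWithinAt) hwt (h.deriv_w t ht0) hot
    (fun s hs => hu s ⟨ht.1.trans hs.1, hs.2⟩) huβ.ge (hu t ⟨ht.1, htβ⟩).le
  refine ⟨(hafter β ⟨htβ, le_rfl⟩).1, ?_, fun s hs hvs => ?_⟩
  · have h1 : 0 < radialWronskian u v w o ζ := by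
      rw [hKζ, mul_assoc, mul_div_assoc]
      exact mul_pos (hafter ζ ⟨htζ', hζ.2.le⟩).1 hfac
    refine h1.trans_le (h.monotoneOn_radialWronskian hζpos (fun s hs => ?_) (left_mem_Icc.2 hζ.2.le)
      (right_mem_Icc.2 hζ.2.le) hζ.2.le)
    exact (mul_pos (hafter s ⟨htζ'.trans hs.1, hs.2.le⟩).1 (hzpos s ⟨hs.1, hs.2.le⟩)).le
  · have hus := hu s hs
    -- At a zero of v one has u - s v = u > 0, so it lies beyond ζ, hence beyond t; there the
    -- Wronskian with u is -o u, and its negative sign gives o > 0.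
    have hts : t < s := by
      by_contra! hle
      have := hzneg s ⟨hs.1.le, hle.trans_lt htζ'⟩
      rw [hvs] at this
      linarith
    have := (hafter s ⟨hts, hs.2.le⟩).2
    rw [hvs] at this
    nlinarith

/-- The half-swing that starts at the free end. -/
theorem first_swing (h : IsVariation u v w o) {β c : ℝ} (hβ : 0 < β) (hcu : Continuous u)
    (hcv : Continuous v) (hco : Continuous o) (hu0 : u 0 = 0) (hw0 : w 0 = 0) (ho0 : o 0 = 1)
    (hdw : HasDerivAt w 1 0) (hlimu : Tendsto (fun s => u s / s) (𝓝[>] 0) (𝓝 c)) (hv0 : v 0 = c)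
    (huβ : u β = 0) (hu : ∀ s ∈ Ioo 0 β, 0 < u s) :
    0 < w β ∧ 0 < radialWronskian u v w o β ∧ ∀ s ∈ Ioo 0 β, v s = 0 → 0 < o s := by
  have hcw : ∀ s, 0 ≤ s → ContinuousAt w s := fun s hs => by
    rcases hs.eq_or_lt with rfl | hs
    · exact hdw.continuousAt
    · exact (h.deriv_w s hs).continuousAt
  have hwon : ContinuousOn w (Icc 0 β) := fun s hs => (hcw s hs.1).continuousWithinAt
  have hafter := h.pos_after le_rfl (β := β) (by fun_prop) hwon hw0 (by rwa [ho0]) (by rw [ho0]; exact one_pos)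
    hu huβ.ge hu0.ge
  have hzmono := h.strictMonoOn_sub le_rfl (by fun_prop) hu
  have hzpos : ∀ s ∈ Ioc 0 β, 0 < u s - s * v s := fun s hs => by
    have := hzmono (left_mem_Icc.2 hβ.le) ⟨hs.1.le, hs.2⟩ hs.1
    simpa [hu0] using this
  refine ⟨(hafter β ⟨hβ, le_rfl⟩).1, ?_, fun s hs hvs => ?_⟩
  · have hmono : StrictMonoOn (radialWronskian u v w o) (Ioc 0 β) := by
      apply strictMonoOn_of_hasDerivWithinAt_pos (convex_Ioc 0 β)
        (f' := fun s => 3 / 4 * (w s * (u s - s * v s)) / (s ^ 2 * √s))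
      · exact fun s hs => (h.hasDerivAt_radialWronskian hs.1).continuousAt.continuousWithinAt
      · intro s hs
        rw [interior_Ioc] at hs
        exact (h.hasDerivAt_radialWronskian hs.1).hasDerivWithinAt
      · intro s hs
        rw [interior_Ioc] at hs
        have h1 := (hafter s ⟨hs.1, hs.2.le⟩).1
        have h2 := hzpos s ⟨hs.1, hs.2.le⟩
        have h3 := hs.1
        positivity
    have hlimw : Tendsto (fun s => w s / s) (𝓝[>] 0) (𝓝 1) := by
      have := (hasDerivAt_iff_tendsto_slope.1 hdw).mono_left
        (nhdsWithin_mono _ fun x (hx : (0 : ℝ) < x) => hx.ne')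
      refine this.congr fun s => ?_
      rw [slope_def_field, hw0, sub_zero, sub_zero]
    have hlimv : Tendsto v (𝓝[>] 0) (𝓝 c) := by
      rw [← hv0]; exact hcv.continuousAt.mono_left nhdsWithin_le_nhds
    have hlimo : Tendsto o (𝓝[>] 0) (𝓝 1) := by
      rw [← ho0]; exact hco.continuousAt.mono_left nhdsWithin_le_nhds
    have hsqrt : Tendsto (fun s : ℝ => √s) (𝓝[>] 0) (𝓝 0) := by
      have := (Real.continuous_sqrt.tendsto 0).mono_left (nhdsWithin_le_nhds (s := Ioi 0))
      simpa using this
    have hid : Tendsto (fun s : ℝ => s) (𝓝[>] 0) (𝓝 0) :=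
      (continuous_id.tendsto (0 : ℝ)).mono_left nhdsWithin_le_nhds
    have hpull : Tendsto (fun s => pull 1 (u s / s)) (𝓝[>] 0) (𝓝 (pull 1 c)) :=
      ((hasDerivAt_pull 1 c).continuousAt.tendsto).comp hlimu
    -- In terms of w/s and u/s, which have limits at 0, the radial Wronskian is √s times a bounded
    -- expression. Starting from 0 and strictly increasing, it is positive at β.
    have hlim : Tendsto (radialWronskian u v w o) (𝓝[>] 0) (𝓝 0) := by
      have key : Tendsto (fun s => √s * (s * (w s / s) * pull 1 (u s / s)
          - (w s / s) * (u s / s - v s) / 2 - o s * (u s / s - v s))) (𝓝[>] 0)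
          (𝓝 (0 * (0 * 1 * pull 1 c - 1 * (c - c) / 2 - 1 * (c - c)))) :=
        hsqrt.mul ((((hid.mul hlimw).mul hpull).sub
          ((hlimw.mul (hlimu.sub hlimv)).div_const 2)).sub (hlimo.mul (hlimu.sub hlimv)))
      rw [zero_mul] at key
      refine key.congr' ?_
      filter_upwards [self_mem_nhdsWithin] with s (hs : 0 < s)
      have hss : √s ^ 2 = s := Real.sq_sqrt hs.le
      have hsq : 0 < √s := Real.sqrt_pos.2 hs
      rw [radialWronskian]
      generalize pull 1 (u s / s) = F
      rw [eq_div_iff hsq.ne']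
      have hs' := hs.ne'
      calc _ = √s ^ 2 * (s * (w s / s) * F - (w s / s) * (u s / s - v s) / 2
            - o s * (u s / s - v s)) := by ring
        _ = _ := by
          rw [hss]
          field_simp
    have h1 : 0 ≤ radialWronskian u v w o (β / 2) := by
      refine le_of_tendsto hlim ?_
      filter_upwards [Ioo_mem_nhdsGT (show (0 : ℝ) < β / 2 by linarith)] with s hs
      exact (hmono ⟨hs.1, by linarith [hs.2]⟩ ⟨by linarith, by linarith⟩ hs.2).le
    have h2 := hmono ⟨by linarith, by linarith⟩ (right_mem_Ioc.2 hβ) (show β / 2 < β by linarith)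
    linarith
  · have := (hafter s ⟨hs.1, hs.2.le⟩).2
    have hus := hu s hs
    rw [hvs] at this
    nlinarith

end IsVariation

/-! ### Dependence on the initial slope: the zeros move outwards. -/

theorem continuous_linearForce (a : ℝ) :
    Continuous fun p : ℝ × ℝ => invHyp (a * avg (prof a) p.1) ^ 3 * p.2 := by
  have h1 := continuous_avg (prof_spec a).cont
  have h2 := continuous_invHyp
  fun_prop

theorem abs_linearForce_sub_le (q x x' : ℝ) :
    |invHyp q ^ 3 * x - invHyp q ^ 3 * x'| ≤ |x - x'| := by
  have h1 := invHyp_pos q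
  rw [← mul_sub, abs_mul, abs_of_pos (by positivity)]
  exact mul_le_of_le_one_left (abs_nonneg _) (pow_le_one₀ h1.le (invHyp_le_one _))

/-- The derivative of the slope `a * prof a` with respect to `a`. -/
noncomputable def variation (a : ℝ) : ℝ → ℝ :=
  (exists_isVolterra 1 (G := fun t ρ => invHyp (a * avg (prof a) t) ^ 3 * ρ)
    (continuous_linearForce a) (fun _ => abs_linearForce_sub_le _) (fun _ => mul_zero _)).choose

theorem variation_spec (a : ℝ) :
    IsVolterra 1 (fun t ρ => invHyp (a * avg (prof a) t) ^ 3 * ρ) (variation a) :=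
  (exists_isVolterra 1 (G := fun t ρ => invHyp (a * avg (prof a) t) ^ 3 * ρ)
    (continuous_linearForce a) (fun _ => abs_linearForce_sub_le _)
    (fun _ => mul_zero _)).choose_spec.1

theorem isVariation_prof (a : ℝ) :
    IsVariation (fun s => a * prim a s) (fun s => a * prof a s)
      (fun s => s * avg (variation a) s) (variation a) where
  deriv_u := fun s _ => (hasDerivAt_prim a s).const_mul a
  deriv_v := fun s hs => by
    rw [mul_div_assoc, pull_one_mul, ← mul_neg]
    exact (hasDerivAt_prof a hs).const_mul a
  deriv_w := fun s _ => hasDerivAt_mul_avg (variation_spec a).cont s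
  deriv_o := fun s hs => by
    rw [mul_div_assoc, prim_div a hs.ne', mul_div_cancel_left₀ _ hs.ne']
    exact (variation_spec a).hasDerivAt (continuous_linearForce a) hs

theorem neg_one_pow_mul_prim_pos {a s : ℝ} {n : ℕ} (hs : 0 ≤ s) (h1 : n * Real.pi < angle a s)
    (h2 : angle a s < (n + 1) * Real.pi) : 0 < (-1) ^ n * prim a s := by
  obtain ⟨c, hc, -, h⟩ := exists_polar a hs
  have h3 := Real.sin_pos_of_pos_of_lt_pi (x := angle a s - n * Real.pi) (by linarith) (by linarith)
  rw [Real.sin_sub_nat_mul_pi] at h3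
  rw [h, mul_left_comm]
  exact mul_pos hc h3

theorem prim_timeOf (a : ℝ) (n : ℕ) : prim a (timeOf (n * Real.pi) a) = 0 := by
  obtain ⟨c, -, -, h⟩ := exists_polar a (timeOf_nonneg (n * Real.pi) a)
  rw [h, angle_timeOf (by positivity), Real.sin_nat_mul_pi, mul_zero]

theorem neg_one_pow_mul_prof_timeOf_pos (a : ℝ) (n : ℕ) :
    0 < (-1) ^ n * prof a (timeOf (n * Real.pi) a) := by
  obtain ⟨c, hc, h, -⟩ := exists_polar a (timeOf_nonneg (n * Real.pi) a)
  rw [h, angle_timeOf (by positivity), mul_left_comm, Real.cos_nat_mul_pi, ← mul_pow]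
  simpa using hc

/-- Over every half-swing the variation of the shape lags behind the shape by less than a
half-turn. -/
theorem variation_swing {a : ℝ} (ha : 0 < a) (n : ℕ) :
    let β := timeOf ((n + 1 : ℕ) * Real.pi) a
    0 < (-1) ^ n * (β * avg (variation a) β) ∧
      0 < radialWronskian (fun s => a * prim a s) (fun s => a * prof a s)
        (fun s => s * avg (variation a) s) (variation a) β ∧
      ∀ s ∈ Ioo (timeOf (n * Real.pi) a) β, prof a s = 0 → 0 < (-1) ^ n * variation a s := by
  have hvar := isVariation_prof a
  have hpi := Real.pi_pos
  have hmem : ∀ (n : ℕ) s, s ∈ Ioo (timeOf (n * Real.pi) a) (timeOf ((n + 1 : ℕ) * Real.pi) a) →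
      0 < (-1) ^ n * prim a s := by
    intro n s hs
    have h0 : 0 ≤ s := (timeOf_nonneg _ _).trans hs.1.le
    have h1 := (timeOf_lt_iff (by positivity) a h0).1 hs.1
    have h2 := (lt_timeOf_iff (by positivity) a h0).1 hs.2
    push_cast at h2
    exact neg_one_pow_mul_prim_pos h0 h1 h2
  induction n with
  | zero =>
    have hc := (prof_spec a).cont
    have hco := (variation_spec a).cont
    have hcu : Continuous (prim a) :=
      continuous_iff_continuousAt.2 fun t => (hasDerivAt_prim a t).continuousAt
    have hβ : 0 < timeOf ((0 + 1 : ℕ) * Real.pi) a := timeOf_pos (by simpa using hpi) a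
    have key := hvar.first_swing (c := a) hβ (by fun_prop) (by fun_prop) hco (by simp [prim_zero])
      (by simp) (variation_spec a).zero
      (by simpa [(variation_spec a).zero] using hasDerivAt_mul_avg hco 0) ?_ (by simp [prof_zero])
      (by rw [prim_timeOf, mul_zero]) (fun s hs => mul_pos ha ?_)
    · refine ⟨by simpa using key.1, key.2.1, fun s hs h0 => ?_⟩
      have h1 := key.2.2 s (by simpa [timeOf_zero] using hs) (by simp [h0])
      simpa using h1
    · have h1 : Tendsto (fun s => a * avg (prof a) s) (𝓝[>] 0) (𝓝 a) := by
        have := ((continuous_avg hc).const_mul a).tendsto 0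
        rw [avg_zero, prof_zero, mul_one] at this
        exact this.mono_left nhdsWithin_le_nhds
      refine h1.congr' ?_
      filter_upwards [self_mem_nhdsWithin] with s (hs : 0 < s)
      rw [mul_div_assoc, prim_div a hs.ne']
    · have := hmem 0 s (by simpa [timeOf_zero] using hs)
      simpa using this
  | succ n ih =>
    obtain ⟨hw, hK, -⟩ := ih
    set α := timeOf ((n + 1 : ℕ) * Real.pi) a with hα
    intro β
    have hα0 : 0 < α := timeOf_pos (by positivity) a
    have hαβ : α < β := timeOf_lt_timeOf (by positivity) (by push_cast; nlinarith) a
    have huα : prim a α = 0 := prim_timeOf a (n + 1)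
    have huβ : prim a β = 0 := prim_timeOf a (n + 1 + 1)
    have hvα := neg_one_pow_mul_prof_timeOf_pos a (n + 1)
    have hvβ := neg_one_pow_mul_prof_timeOf_pos a (n + 1 + 1)
    have hu := hmem (n + 1)
    rw [pow_succ (-1 : ℝ) (n + 1)] at hvβ
    -- The swings alternate in sign. When u is negative, all four functions are negated, which
    -- leaves the radial Wronskian unchanged, so the same half-swing lemma serves both parities.
    rcases neg_one_pow_eq_or ℝ (n + 1) with e | e
    · have e' : (-1 : ℝ) ^ n = -1 := by rw [pow_succ] at e; linarith
      rw [e] at hvα hvβ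
      rw [e'] at hw
      have key := hvar.half_swing hα0 hαβ (by simp [huα]) (by simp [huβ])
        (fun s hs => mul_pos ha (by simpa [e] using hu s hs)) (mul_pos ha (by rwa [one_mul] at hvα))
        (mul_neg_of_pos_of_neg ha (by linarith)) (by linarith) hK
      refine ⟨by rw [e, one_mul]; exact key.1, key.2.1, fun s hs h0 => ?_⟩
      rw [e, one_mul]
      exact key.2.2 s hs (by simp [h0])
    · have e' : (-1 : ℝ) ^ n = 1 := by rw [pow_succ] at e; linarith
      rw [e] at hvα hvβ
      rw [e'] at hw
      have key := hvar.neg.half_swing hα0 hαβ (by simp [huα]) (by simp [huβ])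
        (fun s hs => ?_) ?_ ?_ ?_ (by rw [IsVariation.radialWronskian_neg]; exact hK)
      · rw [IsVariation.radialWronskian_neg] at key
        refine ⟨by rw [e]; simpa using key.1, key.2.1, fun s hs h0 => ?_⟩
        rw [e]
        have := key.2.2 s hs (by simp [h0])
        simpa using this
      · have := hu s hs
        rw [e] at this
        simp only [Pi.neg_apply]
        nlinarith
      · simp only [Pi.neg_apply]
        nlinarith
      · simp only [Pi.neg_apply]
        nlinarith
      · simp only [Pi.neg_apply]
        linarith

/-- The angle (n + 1/2)π of `tau n a` lies between nπ and (n + 1)π, so this zero of v belongs to the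
n-th half-swing. -/
theorem neg_one_pow_mul_variation_tau_pos {a : ℝ} (ha : 0 < a) (n : ℕ) :
    0 < (-1) ^ n * variation a (tau n a) := by
  have hpi := Real.pi_pos
  refine (variation_swing ha n).2.2 _ ⟨?_, ?_⟩ (prof_tau n a)
  · exact timeOf_lt_timeOf (by positivity) (by nlinarith) a
  · exact timeOf_lt_timeOf (tau_level_pos n).le (by push_cast; nlinarith) a

/-- First-order expansion of the slope in the initial slope. -/
theorem abs_slope_sub_linear_le (a b : ℝ) {s : ℝ} (hs : 0 ≤ s) :
    |b * prof b s - (a * prof a s + (b - a) * variation a s)| ≤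
      2 * (s * (3 * (2 * Real.exp (2 * s)) ^ 2)) * Real.exp (2 * s) * (b - a) ^ 2 := by
  set C := 2 * Real.exp (2 * s) with hC
  have hca := (isVolterra_mul_prof a).cont
  have hcb := (isVolterra_mul_prof b).cont
  have hco := (variation_spec a).cont
  -- The linear approximation solves the Volterra equation whose force is the tangent of `pull 1`
  -- along the shot a. Stability then turns the Taylor remainder of the force into the error bound.
  have hlin : IsVolterra b (fun t ρ => pull 1 (a * avg (prof a) t) +
      invHyp (a * avg (prof a) t) ^ 3 * (ρ - a * avg (prof a) t))
      (fun s => a * prof a s + (b - a) * variation a s) := by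
    refine ⟨by fun_prop, fun x hx => ?_⟩
    have e : ∀ t, avg (fun s => a * prof a s + (b - a) * variation a s) t =
        a * avg (prof a) t + (b - a) * avg (variation a) t := fun t => by
      rw [avg_add hca (by fun_prop), avg_const_mul, avg_const_mul]
    have h1 := (isVolterra_mul_prof a).eq x hx
    have h2 := (variation_spec a).eq x hx
    simp_rw [e, add_sub_cancel_left]
    simp_rw [avg_const_mul] at h1
    have i1 := continuous_comp_avg (G := fun _ ρ => pull 1 ρ) (continuous_pull_const 1) hca
    have i2 := continuous_comp_avg (G := fun t ρ => invHyp (a * avg (prof a) t) ^ 3 * ρ)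
      (continuous_linearForce a) hco
    simp_rw [avg_const_mul] at i1
    have e2 : ∀ t, invHyp (a * avg (prof a) t) ^ 3 * ((b - a) * avg (variation a) t) =
        (b - a) * (invHyp (a * avg (prof a) t) ^ 3 * avg (variation a) t) := fun t => by ring
    simp_rw [e2]
    rw [intervalIntegral.integral_add (i1.intervalIntegrable _ _)
      ((i2.const_mul (b - a)).intervalIntegrable _ _), intervalIntegral.integral_const_mul, h1, h2]
    ring
  have hdiff : ∀ t ∈ Icc 0 s, |b * avg (prof b) t - a * avg (prof a) t| ≤ C * |b - a| := by
    intro t ht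
    rw [← avg_const_mul, ← avg_const_mul, ← avg_sub hcb hca]
    apply abs_avg_le ht.1
    intro x hx
    have := (isVolterra_mul_prof b).abs_sub_le (isVolterra_mul_prof a) (continuous_pull_const 1)
      (continuous_pull_const 1) (fun _ => abs_pull_sub_le 1) (S := s) (δ := 0) (ε := |b - a|) le_rfl
      (by simp) (by simp) ⟨hx.1, hx.2.trans ht.2⟩
    refine this.trans ?_
    have hxs := hx.2.trans ht.2
    calc 2 * |b - a| * Real.exp (2 * x) ≤ 2 * |b - a| * Real.exp (2 * s) := by gcongr
      _ = _ := by rw [hC]; ring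
  have := (isVolterra_mul_prof b).abs_sub_le hlin (continuous_pull_const 1) ?_ ?_ (S := s)
    (δ := 3 * (C * |b - a|) ^ 2) (ε := s * (3 * (C * |b - a|) ^ 2)) (by positivity)
    (fun t ht => ?_) (by simp) ⟨hs, le_rfl⟩
  · refine this.trans (le_of_eq ?_)
    rw [mul_pow, sq_abs]
    ring
  · have h1 := continuous_avg (prof_spec a).cont
    have h2 := continuous_invHyp
    have h3 : Continuous (pull 1) :=
      continuous_iff_continuousAt.2 fun x => (hasDerivAt_pull 1 x).continuousAt
    fun_prop
  · intro t x x'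
    have := abs_linearForce_sub_le (a * avg (prof a) t) (x - a * avg (prof a) t)
      (x' - a * avg (prof a) t)
    simpa using this
  · rw [avg_const_mul]
    refine (abs_pull_one_taylor_le _ _).trans ?_
    rw [← sq_abs (b * avg (prof b) t - _)]
    have := hdiff t ht
    gcongr

/-- At s = tau n a the slope of the shot b is (b - a) · variation up to O((b - a)²), so for b
slightly above a it has the sign (-1)^n, the sign before the n-th zero: this zero has not yet
occurred. -/
theorem eventually_tau_lt {a : ℝ} (ha : 0 < a) (n : ℕ) : ∀ᶠ b in 𝓝[>] a, tau n a < tau n b := by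
  set s := tau n a with hs
  have hs0 : 0 < s := tau_pos n a
  set C := 2 * (s * (3 * (2 * Real.exp (2 * s)) ^ 2)) * Real.exp (2 * s) with hC
  have hω := neg_one_pow_mul_variation_tau_pos ha n
  rw [← hs] at hω
  set ω := (-1) ^ n * variation a s with hωd
  have hM := tau_level_pos n
  have hpi := Real.pi_pos
  have h1 : ∀ᶠ b in 𝓝 a, C * (b - a) < ω := by
    have : Continuous fun b => C * (b - a) := by fun_prop
    have h := this.tendsto a
    simp only [sub_self, mul_zero] at h
    exact h.eventually (gt_mem_nhds hω)
  -- Keeps angle b s - nπ below π, so that a positive cosine really means that π/2 has not been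
  -- reached.
  have h2 : ∀ᶠ b in 𝓝 a, angle b s < (n + 1 / 2) * Real.pi + Real.pi / 2 := by
    have : Continuous fun b => angle b s := continuous_angle.comp (f := fun b => (b, s)) (by fun_prop)
    refine (this.tendsto a).eventually (gt_mem_nhds ?_)
    rw [hs, tau, angle_timeOf hM.le]
    linarith
  filter_upwards [nhdsWithin_le_nhds h1, nhdsWithin_le_nhds h2, self_mem_nhdsWithin]
    with b hb1 hb2 (hab : a < b)
  have hb : 0 < b := ha.trans hab
  have h3 := abs_slope_sub_linear_le a b hs0.le
  rw [← hC, show prof a s = 0 from prof_tau n a, mul_zero, zero_add] at h3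
  have h4 : 0 < (-1) ^ n * prof b s := by
    have h5 : |(-1) ^ n * (b * prof b s - (b - a) * variation a s)| ≤ C * (b - a) ^ 2 := by
      rw [abs_mul, abs_pow, abs_neg, abs_one, one_pow, one_mul]
      exact h3
    have h6 := (abs_le.1 h5).1
    have h7 : (-1) ^ n * (b * prof b s - (b - a) * variation a s) =
        b * ((-1) ^ n * prof b s) - (b - a) * ω := by rw [hωd]; ring
    rw [h7] at h6
    have h8 : 0 < (b - a) * (ω - C * (b - a)) := mul_pos (by linarith) (by linarith)
    have h9 : 0 < b * ((-1) ^ n * prof b s) := by nlinarith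
    exact pos_of_mul_pos_right h9 hb.le
  obtain ⟨c, hc, h5, -⟩ := exists_polar b hs0.le
  have h6 : 0 < Real.cos (angle b s - n * Real.pi) := by
    rw [Real.cos_sub_nat_mul_pi]
    rw [h5, mul_left_comm] at h4
    exact pos_of_mul_pos_right h4 hc.le
  rw [tau, lt_timeOf_iff hM.le b hs0.le]
  by_contra! h7
  have h8 : Real.cos (angle b s - n * Real.pi) ≤ 0 :=
    Real.cos_nonpos_of_pi_div_two_le_of_le (by linarith) (by linarith)
  linarith

/-- The zeros of the profile move outwards as the initial slope grows. -/
theorem strictMonoOn_tau (n : ℕ) : StrictMonoOn (tau n) (Ici 0) := by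
  have hc := continuous_tau n
  have hmono : ∀ a b, 0 < a → a ≤ b → tau n a ≤ tau n b := by
    intro a b ha hab
    -- Increase immediately to the right of every point, with continuity, propagates along the
    -- interval.
    have hcl : IsClosed ({x | tau n a ≤ tau n x} ∩ Icc a b) :=
      (isClosed_le continuous_const hc).inter isClosed_Icc
    refine hcl.Icc_subset_of_forall_mem_nhdsWithin (le_refl (tau n a)) (fun x hx => ?_)
      (right_mem_Icc.2 hab)
    filter_upwards [eventually_tau_lt (ha.trans_le hx.2.1) n] with y hy
    exact le_trans hx.1 hy.le
  have hpos : ∀ a b, 0 < a → a < b → tau n a < tau n b := by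
    intro a b ha hab
    obtain ⟨c, hc1, hc2⟩ := ((eventually_tau_lt ha n).and (Ioo_mem_nhdsGT hab)).exists
    exact hc1.trans_le (hmono c b (ha.trans hc2.1) hc2.2.le)
  intro a ha b _ hab
  rcases (show 0 ≤ a from ha).eq_or_lt with rfl | ha
  · have h1 : tau n 0 ≤ tau n (b / 2) := by
      refine le_of_tendsto (hc.continuousAt.mono_left (nhdsWithin_le_nhds (s := Ioi 0))) ?_
      filter_upwards [Ioo_mem_nhdsGT (show (0 : ℝ) < b / 2 by linarith)] with x hx
      exact hmono x _ hx.1 hx.2.le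
    exact h1.trans_lt (hpos _ _ (by linarith) (by linarith))
  · exact hpos a b ha hab

/-- The force is less than 1 in absolute value, so the slope needs at least time a to fall from a to
0. -/
theorem le_tau (a : ℝ) (n : ℕ) : a ≤ tau n a := by
  have hs := tau_pos n a
  have h1 := (isVolterra_mul_prof a).eq (tau n a) hs.le
  simp only [prof_tau, mul_zero] at h1
  have h2 := intervalIntegral.norm_integral_le_of_norm_le_const (a := (0 : ℝ)) (b := tau n a)
    (C := 1) (f := fun t => pull 1 (avg (fun s => a * prof a s) t))
    (fun t _ => (abs_pull_one_le _).le)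
  rw [sub_zero, one_mul, abs_of_pos hs, Real.norm_eq_abs] at h2
  linarith [le_abs_self (∫ t in (0 : ℝ)..tau n a, pull 1 (avg (fun s => a * prof a s) t))]

/-! ### The limit a = 0 and the Bessel function. -/

/-- The partial sums of the series of `J₀ (2 √s)`. -/
noncomputable def besselSum (n : ℕ) (s : ℝ) : ℝ :=
  ∑ k ∈ Finset.range n, (-1) ^ k / ((k.factorial : ℝ) ^ 2) * s ^ k

theorem continuous_besselSum (n : ℕ) : Continuous (besselSum n) := by
  unfold besselSum
  fun_prop

theorem integral_avg_pow (n : ℕ) (s : ℝ) :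
    ∫ t in (0 : ℝ)..s, avg (fun x => x ^ n) t = s ^ (n + 1) / ((n : ℝ) + 1) ^ 2 := by
  have h : ∀ t, avg (fun x => x ^ n) t = t ^ n / ((n : ℝ) + 1) := fun t => by
    simp only [avg, mul_pow, intervalIntegral.integral_mul_const, integral_pow]
    simp
    ring
  simp_rw [h, intervalIntegral.integral_div, integral_pow]
  simp
  field_simp

/-- The partial sums are the Picard iterates at a = 0, begun at the zero function: averaging and
integrating x^n divides by (n + 1)², which builds the squared factorial. -/
theorem besselSum_succ_eq (n : ℕ) (s : ℝ) :
    besselSum (n + 1) s = 1 - ∫ t in (0 : ℝ)..s, avg (besselSum n) t := by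
  induction n with
  | zero => simp [besselSum, avg]
  | succ n ih =>
    have h1 : besselSum (n + 1 + 1) s = besselSum (n + 1) s +
        (-1) ^ (n + 1) / (((n + 1).factorial : ℝ) ^ 2) * s ^ (n + 1) := by
      rw [besselSum, Finset.sum_range_succ]; rfl
    have h2 : besselSum (n + 1) = fun s => besselSum n s +
        (-1) ^ n / ((n.factorial : ℝ) ^ 2) * s ^ n := by
      ext s; rw [besselSum, Finset.sum_range_succ]; rfl
    have hc := continuous_besselSum n
    have h3 : ∀ t, avg (besselSum (n + 1)) t = avg (besselSum n) t +
        (-1) ^ n / ((n.factorial : ℝ) ^ 2) * avg (fun x => x ^ n) t := fun t => by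
      rw [h2, avg_add hc (by fun_prop), avg_const_mul]
    have hp : Continuous (avg fun x : ℝ => x ^ n) := continuous_avg (by fun_prop)
    rw [h1, ih]
    simp_rw [h3]
    rw [intervalIntegral.integral_add ((continuous_avg hc).intervalIntegrable _ _)
      ((hp.const_mul _).intervalIntegrable _ _), intervalIntegral.integral_const_mul,
      integral_avg_pow, Nat.factorial_succ]
    have : (n.factorial : ℝ) ≠ 0 := by positivity
    push_cast
    field_simp
    ring

/-- Each Picard step integrates the previous error once, and averaging does not enlarge an
increasing bound; hence the factor s^n/n!. -/
theorem abs_prof_zero_sub_besselSum_le {S : ℝ} (n : ℕ) {s : ℝ} (hs : s ∈ Icc 0 S) :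
    |prof 0 s - besselSum n s| ≤ 2 * Real.exp (2 * S) * (s ^ n / n.factorial) := by
  induction n generalizing s with
  | zero =>
    have := abs_prof_le 0 hs.1
    have h2 := hs.2
    simp only [besselSum, Finset.range_zero, Finset.sum_empty, sub_zero, pow_zero,
      Nat.factorial_zero, Nat.cast_one, div_one, mul_one]
    exact this.trans (by gcongr)
  | succ n ih =>
    have hcp := (prof_spec 0).cont
    have hcb := continuous_besselSum n
    have h1 := (prof_spec 0).eq s hs.1
    have hp : ∀ ρ, pull 0 ρ = ρ := fun ρ => by simp [pull, invHyp]
    simp_rw [hp] at h1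
    have h2 : prof 0 s - besselSum (n + 1) s =
        -∫ t in (0 : ℝ)..s, avg (fun x => prof 0 x - besselSum n x) t := by
      simp_rw [avg_sub hcp hcb]
      rw [intervalIntegral.integral_sub ((continuous_avg hcp).intervalIntegrable _ _)
        ((continuous_avg hcb).intervalIntegrable _ _), besselSum_succ_eq, h1]
      ring
    have h3 : ∫ t in (0 : ℝ)..s, 2 * Real.exp (2 * S) * (t ^ n / n.factorial) =
        2 * Real.exp (2 * S) * (s ^ (n + 1) / (n + 1).factorial) := by
      rw [intervalIntegral.integral_const_mul, intervalIntegral.integral_div, integral_pow,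
        Nat.factorial_succ]
      have : (n.factorial : ℝ) ≠ 0 := by positivity
      push_cast
      field_simp
      simp
    rw [h2, abs_neg, ← h3, ← Real.norm_eq_abs]
    apply intervalIntegral.norm_integral_le_of_norm_le hs.1
    · refine Eventually.of_forall fun t ht => abs_avg_le ht.1.le fun x hx => ?_
      refine (ih ⟨hx.1, hx.2.trans (ht.2.trans hs.2)⟩).trans ?_
      have h4 := hx.1
      have h5 := hx.2
      gcongr
    · apply Continuous.intervalIntegrable
      fun_prop

theorem prof_zero_eq_besselJ0 (x : ℝ) : prof 0 (x ^ 2 / 4) = besselJ0 x := by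
  set s := x ^ 2 / 4 with hs
  have hs0 : 0 ≤ s := by positivity
  have hterm : ∀ k : ℕ, (x / 2) ^ (2 * k) = s ^ k := fun k => by
    rw [pow_mul, hs]; congr 1; ring
  have hsum : Summable fun k : ℕ => (-1) ^ k / ((k.factorial : ℝ) ^ 2) * s ^ k := by
    refine Summable.of_norm_bounded (Real.summable_pow_div_factorial s) fun k => ?_
    have h1 : (1 : ℝ) ≤ k.factorial := by exact_mod_cast Nat.factorial_pos k
    rw [norm_mul, norm_div, norm_pow, norm_neg, norm_one, one_pow, norm_pow, norm_pow,
      Real.norm_of_nonneg hs0, Real.norm_of_nonneg (by positivity : (0 : ℝ) ≤ k.factorial),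
      one_div_mul_eq_div]
    gcongr
    nlinarith
  have h1 : Tendsto (fun n => besselSum n s) atTop (𝓝 (besselJ0 x)) := by
    have := hsum.hasSum.tendsto_sum_nat
    simp only [besselJ0, hterm]
    exact this
  have h2 : Tendsto (fun n => besselSum n s) atTop (𝓝 (prof 0 s)) := by
    rw [tendsto_iff_norm_sub_tendsto_zero]
    have h3 : Tendsto (fun n : ℕ => 2 * Real.exp (2 * s) * (s ^ n / n.factorial)) atTop (𝓝 0) := by
      simpa using (FloorSemiring.tendsto_pow_div_factorial_atTop s).const_mul (2 * Real.exp (2 * s))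
    refine squeeze_zero (fun n => norm_nonneg _) (fun n => ?_) h3
    rw [norm_sub_rev]
    exact abs_prof_zero_sub_besselSum_le n ⟨hs0, le_rfl⟩
  exact tendsto_nhds_unique h2 h1

/-- Zeros are counted alike after a change of variables. -/
theorem encard_zeros_comp {f g φ : ℝ → ℝ} {z : ℝ} (hz : 0 ≤ z) (hφ : StrictMonoOn φ (Icc 0 z))
    (hc : ContinuousOn φ (Icc 0 z)) (h0 : φ 0 = 0)
    (hfg : ∀ x ∈ Ioo 0 z, f x = 0 ↔ g (φ x) = 0) :
    {x ∈ Ioo 0 z | f x = 0}.encard = {y ∈ Ioo 0 (φ z) | g y = 0}.encard := by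
  have himage : {y ∈ Ioo 0 (φ z) | g y = 0} = φ '' {x ∈ Ioo 0 z | f x = 0} := by
    ext y
    constructor
    · rintro ⟨hy, hgy⟩
      obtain ⟨x, hx, rfl⟩ := intermediate_value_Ioo hz hc (by rwa [h0])
      exact ⟨x, ⟨hx, (hfg x hx).2 hgy⟩, rfl⟩
    · rintro ⟨x, ⟨hx, hfx⟩, rfl⟩
      refine ⟨⟨?_, ?_⟩, (hfg x hx).1 hfx⟩
      · rw [← h0]
        exact hφ (left_mem_Icc.2 hz) ⟨hx.1.le, hx.2.le⟩ hx.1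
      · exact hφ ⟨hx.1.le, hx.2.le⟩ (right_mem_Icc.2 hz) hx.2
  have hinj : InjOn φ {x ∈ Ioo 0 z | f x = 0} :=
    InjOn.mono (s₂ := Icc 0 z) (fun x hx => ⟨hx.1.1.le, hx.1.2.le⟩) hφ.injOn
  rw [himage, hinj.encard_image]

theorem isNthZero_besselJ0 (n : ℕ) : IsNthZero besselJ0 (n + 1) (2 * √(tau n 0)) := by
  have hτ := tau_pos n 0
  have hsq : (2 * √(tau n 0)) ^ 2 / 4 = tau n 0 := by
    rw [mul_pow, Real.sq_sqrt hτ.le]; ring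
  have hpos : 0 < 2 * √(tau n 0) := by positivity
  refine ⟨hpos, ?_, ?_⟩
  · rw [← prof_zero_eq_besselJ0, hsq, prof_tau]
  · rw [encard_zeros_comp (f := besselJ0) (g := prof 0) (φ := fun x => x ^ 2 / 4) hpos.le]
    · simp only [hsq]
      exact ((isNthZero_prof_iff 0 _ n).2 rfl).2.2
    · intro x hx y hy hxy
      have := hx.1
      simp only
      gcongr
    · fun_prop
    · simp
    · intro x _
      simp only [prof_zero_eq_besselJ0]

/-! ### Configurations and shots. -/

theorem dimlessLength_discreteSpeed {g L : ℝ} (hg : 0 < g) (hL : 0 < L) {t : ℝ} (ht : 0 ≤ t) :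
    dimlessLength g L (discreteSpeed g L (2 * √t)) = t := by
  unfold dimlessLength discreteSpeed
  rw [mul_pow, Real.sq_sqrt (by positivity), mul_div_cancel_left₀ _ two_ne_zero, Real.sq_sqrt ht]
  field_simp

theorem hasDerivWithinAt_prof (a : ℝ) {s : ℝ} (hs : 0 ≤ s) :
    HasDerivWithinAt (prof a) (-pull a (avg (prof a) s)) (Ici 0) s := by
  have hc := continuous_comp_avg (G := fun _ ρ => pull a ρ) (continuous_pull_const a)
    (prof_spec a).cont
  have h1 : HasDerivAt (fun s => 1 - ∫ t in (0 : ℝ)..s, pull a (avg (prof a) t))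
      (-pull a (avg (prof a) s)) s :=
    (intervalIntegral.integral_hasDerivAt_right (hc.intervalIntegrable _ _)
      hc.stronglyMeasurable.stronglyMeasurableAtFilter hc.continuousAt).const_sub 1
  exact h1.hasDerivWithinAt.congr (fun t ht => (prof_spec a).eq t ht) ((prof_spec a).eq s hs)

theorem sqrt_one_sub_pull_sq (m : ℝ) : √(1 - pull 1 m ^ 2) = invHyp m := by
  have h : 1 - pull 1 m ^ 2 = invHyp m ^ 2 := by
    have := invHyp_sq m
    rw [pull, one_mul]
    linear_combination -this
  rw [h, Real.sqrt_sq (invHyp_pos m).le]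

theorem pull_div_sqrt_one_sub_sq {x : ℝ} (hx : |x| < 1) : pull 1 (x / √(1 - x ^ 2)) = x := by
  have h : 0 < 1 - x ^ 2 := by
    have := (sq_lt_one_iff_abs_lt_one x).2 hx
    linarith
  have hs : 0 < √(1 - x ^ 2) := Real.sqrt_pos.2 h
  have h1 : 1 + (x / √(1 - x ^ 2)) ^ 2 = ((√(1 - x ^ 2)) ^ 2)⁻¹ := by
    rw [div_pow, Real.sq_sqrt h.le]
    field_simp
    ring
  rw [pull, one_mul, invHyp, h1, Real.sqrt_inv, Real.sqrt_sq hs.le]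
  field_simp

/-- In dimensionless variables a configuration solves the shape equation. -/
theorem IsConfiguration.isBranch {μ g L ω : ℝ} {ρ : ℝ → ℝ} (hμ : 0 < μ) (hg : 0 < g)
    (h : IsConfiguration μ g L ω ρ) :
    IsBranch 1 (dimlessLength g L ω)
      (fun x => -(ω ^ 2 / g / (μ * g) * (μ * g * (x / (ω ^ 2 / g)) /
        √(1 - slope L ρ (x / (ω ^ 2 / g)) ^ 2) * slope L ρ (x / (ω ^ 2 / g)))))
      (fun x => ω ^ 2 / g * ρ (x / (ω ^ 2 / g))) := by
  have hω := h.speed_pos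
  set k := ω ^ 2 / g with hk
  have hk0 : 0 < k := by positivity
  have hT : dimlessLength g L ω = k * L := by rw [dimlessLength, hk]; ring
  rw [hT]
  have hIcc : ∀ x ∈ Icc 0 (k * L), x / k ∈ Icc 0 L := fun x hx =>
    ⟨div_nonneg hx.1 hk0.le, by rw [div_le_iff₀ hk0]; linarith [hx.2]⟩
  have hmem : ∀ x ∈ Ioo 0 (k * L), x / k ∈ Ioo 0 L := fun x hx =>
    ⟨div_pos hx.1 hk0, by rw [div_lt_iff₀ hk0]; linarith [hx.2]⟩
  have hdk : ∀ x, HasDerivAt (fun x => x / k) (1 / k) x := fun x => (hasDerivAt_id' x).div_const k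
  have hmaps : MapsTo (fun x => x / k) (Ioc 0 (k * L)) (Icc 0 L) :=
    fun x hx => hIcc x ⟨hx.1.le, hx.2⟩
  have hck : ContinuousOn (fun x => x / k) (Ioc 0 (k * L)) := by fun_prop
  -- The chain equation is u' = v. The equation for v' is the definition of u solved for the slope,
  -- since `pull 1` inverts x ↦ x/√(1 - x²).
  refine ⟨?_, ?_, fun x hx => ?_, fun x hx => ?_⟩
  · have hP : ContinuousOn (fun t => μ * g * t / √(1 - slope L ρ t ^ 2) * slope L ρ t) (Icc 0 L) :=
      fun s hs => (h.equation s hs).continuousWithinAt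
    exact ((hP.comp hck hmaps).const_mul (k / (μ * g))).neg
  · exact (h.differentiable.continuousOn.comp hck hmaps).const_mul k
  · have hx' := hmem x hx
    have h1 := (h.equation _ ⟨hx'.1.le, hx'.2.le⟩).hasDerivAt (Icc_mem_nhds hx'.1 hx'.2)
    have h2 := ((HasDerivAt.comp (h := fun x => x / k) x h1 (hdk x)).const_mul (k / (μ * g))).neg
    refine h2.congr_deriv ?_
    have : ω ^ 2 = k * g := by rw [hk]; field_simp
    rw [this]
    field_simp
  · have hx' := hmem x hx
    have h1 := ((h.differentiable _ ⟨hx'.1.le, hx'.2.le⟩).hasDerivWithinAt).hasDerivAt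
      (Icc_mem_nhds hx'.1 hx'.2)
    have h2 := (HasDerivAt.comp (h := fun x => x / k) x h1 (hdk x)).const_mul k
    refine h2.congr_deriv ?_
    have h3 := pull_div_sqrt_one_sub_sq (h.slope_lt _ ⟨hx'.1.le, hx'.2.le⟩)
    have h4 := hx.1.ne'
    have e : -(k / (μ * g) * (μ * g * (x / k) / √(1 - slope L ρ (x / k) ^ 2) *
        slope L ρ (x / k))) / x = -(slope L ρ (x / k) / √(1 - slope L ρ (x / k) ^ 2)) := by
      field_simp
    rw [e, pull_neg, h3, neg_neg, slope]
    field_simp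

/-- A configuration is determined by the point that represents it. -/
theorem IsConfiguration.eq_prof {μ g L ω a s : ℝ} {ρ : ℝ → ℝ} (hμ : 0 < μ) (hg : 0 < g)
    (hL : 0 < L) (h : IsConfiguration μ g L ω ρ)
    (hend : endpoint g L ω ρ = (s, a * prim a s, a * prof a s)) :
    s = ω ^ 2 / g * L ∧ ∀ t ∈ Ioc 0 L, ω ^ 2 / g * ρ t = a * prof a (ω ^ 2 / g * t) := by
  have hω := h.speed_pos
  have hk0 : 0 < ω ^ 2 / g := by positivity
  have hB := h.isBranch hμ hg
  simp only [endpoint, Prod.mk.injEq] at hend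
  obtain ⟨h1, h2, h3⟩ := hend
  have hs : s = ω ^ 2 / g * L := by rw [← h1, dimlessLength]; ring
  refine ⟨hs, fun t ht => ?_⟩
  rw [h1] at hB
  have hsL : s / (ω ^ 2 / g) = L := by rw [hs, mul_div_cancel_left₀ _ hk0.ne']
  -- The representing point holds the values of u and v at the attached end, so backward uniqueness
  -- identifies the rescaled configuration with the shot.
  have key := (hB.eqOn ((isShot_prof a).isBranch s) ?_ ?_
    (s := ω ^ 2 / g * t) ⟨mul_pos hk0 ht.1, by rw [hs]; gcongr; exact ht.2⟩).2
  · simpa [mul_div_cancel_left₀ _ hk0.ne'] using key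
  · rw [hsL, ← h2]
    field_simp
  · rw [hsL, ← h3]
    ring

theorem mul_eq_zero_iff_left_of_ne {k x : ℝ} (hk : k ≠ 0) : k * x = 0 ↔ x = 0 := by
  rw [mul_eq_zero, or_iff_right hk]

theorem IsConfiguration.encard_zeros {μ g L ω a s : ℝ} {ρ : ℝ → ℝ} (hμ : 0 < μ) (hg : 0 < g)
    (hL : 0 < L) (ha : 0 < a) (h : IsConfiguration μ g L ω ρ)
    (hend : endpoint g L ω ρ = (s, a * prim a s, a * prof a s)) :
    {t ∈ Ioo 0 L | ρ t = 0}.encard = {x ∈ Ioo 0 s | prof a x = 0}.encard := by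
  obtain ⟨hs, heq⟩ := h.eq_prof hμ hg hL hend
  have hω := h.speed_pos
  have hk0 : 0 < ω ^ 2 / g := by positivity
  rw [encard_zeros_comp (g := prof a) (φ := fun t => ω ^ 2 / g * t) hL.le, ← hs]
  · exact fun x _ y _ hxy => mul_lt_mul_of_pos_left hxy hk0
  · fun_prop
  · simp
  · intro x hx
    have h1 := heq x ⟨hx.1, hx.2.le⟩
    rw [← mul_eq_zero_iff_left_of_ne hk0.ne', h1, mul_eq_zero_iff_left_of_ne ha.ne']

theorem IsConfiguration.isNthZero_iff {μ g L ω a s : ℝ} {ρ : ℝ → ℝ} (hμ : 0 < μ) (hg : 0 < g)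
    (hL : 0 < L) (ha : 0 < a) (h : IsConfiguration μ g L ω ρ)
    (hend : endpoint g L ω ρ = (s, a * prim a s, a * prof a s)) (n : ℕ) :
    IsNthZero ρ (n + 1) L ↔ s = tau n a := by
  obtain ⟨hs, heq⟩ := h.eq_prof hμ hg hL hend
  have hω := h.speed_pos
  have hk0 : 0 < ω ^ 2 / g := by positivity
  have hLe := heq L ⟨hL, le_rfl⟩
  rw [← hs] at hLe
  have hs0 : 0 < s := by rw [hs]; positivity
  have hz : ρ L = 0 ↔ prof a s = 0 := by
    rw [← mul_eq_zero_iff_left_of_ne hk0.ne', hLe, mul_eq_zero_iff_left_of_ne ha.ne']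
  rw [← isNthZero_prof_iff, IsNthZero, IsNthZero, h.encard_zeros hμ hg hL ha hend, hz]
  simp [hL, hs0]

/-- Every point of a shot represents a configuration. -/
theorem exists_isConfiguration {μ g L a s : ℝ} (hg : 0 < g) (hL : 0 < L) (ha : 0 < a)
    (hs : 0 < s) : ∃ ω ρ, IsConfiguration μ g L ω ρ ∧
      endpoint g L ω ρ = (s, a * prim a s, a * prof a s) := by
  -- The scale ω²/g must carry L to s, which fixes ω; then ρ is the slope of the shot in the
  -- rescaled variable, divided by k.
  set k := s / L with hk
  have hk0 : 0 < k := by positivity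
  set ω := √(k * g) with hωd
  have hω : 0 < ω := Real.sqrt_pos.2 (by positivity)
  have hω2 : ω ^ 2 = k * g := Real.sq_sqrt (by positivity)
  have hkL : k * L = s := by rw [hk]; field_simp
  let ρ : ℝ → ℝ := fun t => a / k * prof a (k * t)
  have hρ : ∀ t ∈ Icc 0 L, HasDerivWithinAt ρ (-pull 1 (a * avg (prof a) (k * t))) (Icc 0 L) t := by
    intro t ht
    have h1 := hasDerivWithinAt_prof a (mul_nonneg hk0.le ht.1)
    have h2 : HasDerivWithinAt (fun t => k * t) k (Icc 0 L) t := by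
      simpa using ((hasDerivAt_id' t).const_mul k).hasDerivWithinAt
    have h3 := (HasDerivWithinAt.comp (h := fun t => k * t) t h1 h2
      (fun x hx => mul_nonneg hk0.le hx.1)).const_mul (a / k)
    refine h3.congr_deriv ?_
    rw [pull_one_mul]
    field_simp
  have hslope : ∀ t ∈ Icc 0 L, slope L ρ t = -pull 1 (a * avg (prof a) (k * t)) := fun t ht =>
    (hρ t ht).derivWithin (uniqueDiffOn_Icc hL t ht)
  have hquot : ∀ t ∈ Icc 0 L, slope L ρ t / √(1 - slope L ρ t ^ 2) =
      -(a * avg (prof a) (k * t)) := by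
    intro t ht
    have hq := (invHyp_pos (a * avg (prof a) (k * t))).ne'
    rw [hslope t ht, neg_sq, sqrt_one_sub_pull_sq, pull, one_mul]
    field_simp
  have hLmem : L ∈ Icc 0 L := right_mem_Icc.2 hL.le
  refine ⟨ω, ρ, ⟨hω, ?_, fun t ht => (hρ t ht).differentiableWithinAt, fun t ht => ?_,
    fun t ht => ?_⟩, ?_⟩
  · simp only [ρ, mul_zero, prof_zero, mul_one]
    positivity
  · rw [hslope t ht, abs_neg]
    exact abs_pull_one_le _
  · have hfun : ∀ x ∈ Icc 0 L, μ * g * x / √(1 - slope L ρ x ^ 2) * slope L ρ x =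
        -(μ * g / k * a) * prim a (k * x) := by
      intro x hx
      rw [div_mul_eq_mul_div, mul_div_assoc, hquot x hx, prim]
      field_simp
    have h1 : HasDerivAt (fun x => -(μ * g / k * a) * prim a (k * x))
        (-(μ * g / k * a) * (prof a (k * t) * k)) t :=
      (HasDerivAt.comp (h := fun t => k * t) t (hasDerivAt_prim a (k * t))
        (by simpa using (hasDerivAt_id' t).const_mul k)).const_mul _
    refine (h1.hasDerivWithinAt.congr hfun (hfun t ht)).congr_deriv ?_
    simp only [ρ, hω2]
    field_simp
  · have hT : dimlessLength g L ω = s := by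
      rw [dimlessLength, hω2, ← hkL]; field_simp
    simp only [endpoint, hT, hquot L hLmem, ρ, hω2, Prod.mk.injEq, true_and]
    rw [hkL]
    constructor
    · rw [prim, ← hkL]; field_simp
    · field_simp

/-! ### The surface and the separation of modes. -/

/-- The point of the surface with initial slope `a` and dimensionless length `s`. -/
noncomputable def point (a s : ℝ) : ℝ × ℝ × ℝ := (s, a * prim a s, a * prof a s)

theorem continuous_point : Continuous fun p : ℝ × ℝ => point p.1 p.2 := by
  have h1 := continuous_prim
  have h2 := continuous_prof
  unfold point
  fun_prop

/-- Backward uniqueness makes the two shots agree on (0, s], and their slopes tend to a and b at the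
origin. -/
theorem point_injective {a b s : ℝ} (hs : 0 < s) (h : point a s = point b s) : a = b := by
  simp only [point, Prod.mk.injEq, true_and] at h
  have heq : ∀ t ∈ Ioc 0 s, a * prof a t = b * prof b t := fun t ht =>
    (((isShot_prof a).isBranch s).eqOn ((isShot_prof b).isBranch s) h.1 h.2 ht).2
  have hlim : ∀ c, Tendsto (fun t => c * prof c t) (𝓝[>] 0) (𝓝 c) := fun c => by
    have := ((prof_spec c).cont.const_mul c).tendsto 0
    rw [prof_zero, mul_one] at this
    exact this.mono_left nhdsWithin_le_nhds
  refine tendsto_nhds_unique (hlim a) ((hlim b).congr' ?_)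
  filter_upwards [Ioc_mem_nhdsGT hs] with t ht using (heq t ht).symm

theorem mem_surface_iff {aMax LMax : EReal} {p : ℝ × ℝ × ℝ} :
    p ∈ surface aMax LMax ↔ ∃ a s : ℝ, 0 < a ∧ (a : EReal) < aMax ∧ 0 < s ∧ (s : EReal) < LMax ∧
      p = point a s := by
  constructor
  · rintro ⟨a, s, u, v, ha, haM, hs, hsM, hshot, rfl⟩
    obtain ⟨h1, h2⟩ := hshot.eq_prof hs.le
    exact ⟨a, s, ha, haM, hs, hsM, by rw [point, h1, h2]⟩
  · rintro ⟨a, s, ha, haM, hs, hsM, rfl⟩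
    exact ⟨a, s, _, _, ha, haM, hs, hsM, isShot_prof a, rfl⟩

theorem mem_zeroRadiusLocus_iff {μ g L : ℝ} (hμ : 0 < μ) (hg : 0 < g) (hL : 0 < L)
    {aMax LMax : EReal} {n : ℕ} {p : ℝ × ℝ × ℝ} :
    p ∈ zeroRadiusLocus μ g L aMax LMax (n + 1) ↔
      ∃ a : ℝ, 0 < a ∧ (a : EReal) < aMax ∧ (tau n a : EReal) < LMax ∧ p = point a (tau n a) := by
  constructor
  · rintro ⟨hp, ω, ρ, hconf, hend, hz⟩
    obtain ⟨a, s, ha, haM, -, hsM, rfl⟩ := mem_surface_iff.1 hp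
    have := (hconf.isNthZero_iff hμ hg hL ha hend n).1 hz
    subst this
    exact ⟨a, ha, haM, hsM, rfl⟩
  · rintro ⟨a, ha, haM, hsM, rfl⟩
    obtain ⟨ω, ρ, hconf, hend⟩ := exists_isConfiguration (μ := μ) hg hL ha (tau_pos n a)
    exact ⟨mem_surface_iff.2 ⟨a, _, ha, haM, tau_pos n a, hsM, rfl⟩, ω, ρ, hconf, hend,
      (hconf.isNthZero_iff hμ hg hL ha hend n).2 rfl⟩

theorem encard_zeros_of_mem_rotationMode {μ g L : ℝ} (hμ : 0 < μ) (hg : 0 < g) (hL : 0 < L)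
    {aMax LMax : EReal} {m : ℕ} {a s : ℝ} (ha : 0 < a)
    (hp : point a s ∈ rotationMode μ g L aMax LMax m) :
    {x ∈ Ioo 0 s | prof a x = 0}.encard = m := by
  obtain ⟨-, ω, ρ, hconf, hend, hz⟩ := hp
  rw [← hconf.encard_zeros hμ hg hL ha hend, hz]

theorem abs_slope_sub_le (a : ℝ) {s : ℝ} (hs : 0 ≤ s) : |a - a * prof a s| ≤ s := by
  have h1 := (isVolterra_mul_prof a).eq s hs
  have h2 := intervalIntegral.norm_integral_le_of_norm_le_const (a := (0 : ℝ)) (b := s)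
    (C := 1) (f := fun t => pull 1 (avg (fun s => a * prof a s) t))
    (fun t _ => (abs_pull_one_le _).le)
  rw [sub_zero, one_mul, abs_of_nonneg hs, Real.norm_eq_abs] at h2
  rw [h1, sub_sub_cancel]
  exact h2

/-- The initial slope is a continuous function on the surface. -/
theorem continuousOn_initialSlope {S : Set (ℝ × ℝ × ℝ)} {A : ℝ × ℝ × ℝ → ℝ}
    (hA : ∀ p ∈ S, 0 < p.1 ∧ p = point (A p) p.1) : ContinuousOn A S := by
  intro p₀ hp₀
  set M := |p₀.2.2| + p₀.1 + 1 with hM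
  refine (isCompact_Icc (a := -M) (b := M)).tendsto_nhds_of_unique_mapClusterPt ?_ ?_
  · have hlt : |p₀.2.2| + p₀.1 < M := by rw [hM]; linarith
    have hc : Continuous fun p : ℝ × ℝ × ℝ => |p.2.2| + p.1 := by fun_prop
    filter_upwards [self_mem_nhdsWithin,
      nhdsWithin_le_nhds ((hc.tendsto p₀).eventually (gt_mem_nhds hlt))] with p hp hpM
    obtain ⟨hpos, heq⟩ := hA p hp
    have h1 := abs_slope_sub_le (A p) hpos.le
    have h2 : p.2.2 = A p * prof (A p) p.1 := by
      conv_lhs => rw [heq]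
      rfl
    rw [← h2] at h1
    rw [mem_Icc, ← abs_le]
    have h3 := abs_sub_abs_le_abs_sub (A p) p.2.2
    linarith
  · intro b _ hb
    obtain ⟨U, hU, hlim⟩ := mapClusterPt_iff_ultrafilter.1 hb
    have hid : Tendsto (fun p : ℝ × ℝ × ℝ => p) U (𝓝 p₀) := tendsto_id'.2 (hU.trans nhdsWithin_le_nhds)
    have h1 : Tendsto (fun p : ℝ × ℝ × ℝ => point (A p) p.1) U (𝓝 (point b p₀.1)) :=
      (continuous_point.tendsto (b, p₀.1)).comp
        (hlim.prodMk_nhds ((continuous_fst.tendsto p₀).comp hid))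
    have h2 : Tendsto (fun p : ℝ × ℝ × ℝ => point (A p) p.1) U (𝓝 p₀) := by
      refine hid.congr' ?_
      filter_upwards [hU self_mem_nhdsWithin] with p hp using (hA p hp).2
    obtain ⟨hpos, heq⟩ := hA p₀ hp₀
    exact point_injective hpos ((tendsto_nhds_unique h1 h2).trans heq)

/-- Apply the intermediate value theorem to s - tau n a on T. At most n zeros before s means s ≤ tau
n a, n + 1 zeros means s > tau n a, and a zero of the difference is a point of the locus. -/
theorem locus_separates {μ g L : ℝ} (hμ : 0 < μ) (hg : 0 < g) (hL : 0 < L)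
    {aMax LMax : EReal} {n : ℕ} {T : Set (ℝ × ℝ × ℝ)} (hT : T ⊆ surface aMax LMax)
    (hconn : IsPreconnected T) (h₁ : (T ∩ rotationMode μ g L aMax LMax n).Nonempty)
    (h₂ : (T ∩ rotationMode μ g L aMax LMax (n + 1)).Nonempty) :
    (T ∩ zeroRadiusLocus μ g L aMax LMax (n + 1)).Nonempty := by
  have hex : ∀ p : ℝ × ℝ × ℝ, ∃ a : ℝ, p ∈ surface aMax LMax →
      0 < a ∧ (a : EReal) < aMax ∧ 0 < p.1 ∧ (p.1 : EReal) < LMax ∧ p = point a p.1 := by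
    intro p
    by_cases hp : p ∈ surface aMax LMax
    · obtain ⟨a, s, ha, haM, hs, hsM, rfl⟩ := mem_surface_iff.1 hp
      exact ⟨a, fun _ => ⟨ha, haM, hs, hsM, rfl⟩⟩
    · exact ⟨0, fun h => absurd h hp⟩
  choose A hA using hex
  have hAc : ContinuousOn A T := continuousOn_initialSlope fun p hp =>
    ⟨(hA p (hT hp)).2.2.1, (hA p (hT hp)).2.2.2.2⟩
  have hcont : ContinuousOn (fun p : ℝ × ℝ × ℝ => p.1 - tau n (A p)) T :=
    continuousOn_fst.sub ((continuous_tau n).comp_continuousOn hAc)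
  have hmode : ∀ m, ∀ p ∈ T ∩ rotationMode μ g L aMax LMax m,
      {x ∈ Ioo 0 p.1 | prof (A p) x = 0}.encard = m := by
    rintro m p ⟨hpT, hpm⟩
    obtain ⟨ha, -, -, -, heq⟩ := hA p (hT hpT)
    rw [heq] at hpm
    exact encard_zeros_of_mem_rotationMode hμ hg hL ha hpm
  obtain ⟨p, hp⟩ := h₁
  obtain ⟨q, hq⟩ := h₂
  have hp' : p.1 - tau n (A p) ≤ 0 :=
    sub_nonpos.2 ((encard_zeros_le_iff _ _ n).1 (hmode n p hp).le)
  have hq' : 0 ≤ q.1 - tau n (A q) := by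
    by_contra! hlt
    have h1 := (encard_zeros_le_iff (A q) q.1 n).2 (by linarith)
    rw [hmode (n + 1) q hq] at h1
    have : n + 1 ≤ n := by exact_mod_cast h1
    omega
  obtain ⟨r, hr, hr0⟩ := hconn.intermediate_value hp.1 hq.1 hcont ⟨hp', hq'⟩
  obtain ⟨ha, haM, hs, hsM, heq⟩ := hA r (hT hr)
  have hτ : r.1 = tau n (A r) := sub_eq_zero.1 hr0
  rw [hτ] at hsM heq
  exact ⟨r, hr, (mem_zeroRadiusLocus_iff hμ hg hL).2 ⟨A r, ha, haM, hsM, heq⟩⟩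

/-! ### The locus as a curve. -/

open NNReal in
/-- An open initial segment of `[0, ∞)` is a strictly increasing continuous image of `[0, ∞)`. -/
theorem exists_parametrization {J : Set ℝ≥0} (hJo : IsOpen J) (hJl : IsLowerSet J) (h0 : 0 ∈ J) :
    ∃ φ : ℝ≥0 → ℝ≥0, StrictMono φ ∧ Continuous φ ∧ φ 0 = 0 ∧ range φ = J := by
  by_cases huniv : J = univ
  · exact ⟨id, strictMono_id, continuous_id, rfl, by rw [huniv, range_id]⟩
  obtain ⟨b, hb⟩ := (ne_univ_iff_exists_notMem J).1 huniv
  have hbdd : BddAbove J := ⟨b, fun x hx => by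
    by_contra! hlt
    exact hb (hJl hlt.le hx)⟩
  set A := sSup J with hA
  have hJA : J = Iio A := by
    ext x
    constructor
    · intro hx
      obtain ⟨y, hxy, hy⟩ := mem_nhdsGE_iff_exists_Ico_subset.1
        (nhdsWithin_le_nhds (s := Ici x) (hJo.mem_nhds hx))
      obtain ⟨z, hz1, hz2⟩ := exists_between (show x < y from hxy)
      exact hz1.trans_le (le_csSup hbdd (hy ⟨hz1.le, hz2⟩))
    · intro hx
      obtain ⟨y, hy, hxy⟩ := exists_lt_of_lt_csSup ⟨0, h0⟩ hx
      exact hJl hxy.le hy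
  have hA0 : 0 < A := by rw [hJA] at h0; exact h0
  -- A proper open initial segment is [0, A), and t ↦ A t/(1 + t) maps [0, ∞) onto it.
  have hmono : StrictMono fun t : ℝ≥0 => A * (t / (1 + t)) := by
    intro s t hst
    have : s / (1 + s) < t / (1 + t) := by
      rw [div_lt_div_iff₀ (by positivity) (by positivity), mul_add, mul_add, mul_comm t s]
      simpa using hst
    exact mul_lt_mul_of_pos_left this hA0
  refine ⟨_, hmono, ?_, by simp, ?_⟩
  · refine continuous_const.mul (continuous_id.div (by fun_prop) fun t => ?_)
    positivity
  · rw [hJA]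
    ext x
    constructor
    · rintro ⟨t, rfl⟩
      have : t / (1 + t) < 1 := by
        rw [div_lt_one (by positivity)]
        exact lt_add_of_pos_left t one_pos
      exact mul_lt_of_lt_one_right hA0 this
    · intro hx
      have hx : x < A := hx
      refine ⟨x / (A - x), ?_⟩
      have hsub : 0 < A - x := tsub_pos_of_lt hx
      have e : 1 + x / (A - x) = A / (A - x) := by
        rw [eq_div_iff hsub.ne', add_mul, one_mul, div_mul_cancel₀ _ hsub.ne',
          tsub_add_cancel_of_le hx.le]
      simp only [e]
      field_simp

open NNReal in
theorem exists_locus_curve {μ g L : ℝ} (hμ : 0 < μ) (hg : 0 < g) (hL : 0 < L)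
    {aMax LMax : EReal} (haMax : 0 < aMax) {n : ℕ} (hlt : (tau n 0 : EReal) < LMax) :
    ∃ γ : ℝ≥0 → ℝ × ℝ × ℝ, IsEmbedding γ ∧ γ 0 = (tau n 0, 0, 0) ∧
      γ '' Ioi 0 = zeroRadiusLocus μ g L aMax LMax (n + 1) ∧
      (∀ t, 0 < t → (γ t).2 ≠ (0, 0)) ∧
      (∀ a l : ℝ, (a : EReal) < aMax → (l : EReal) < LMax →
        ∀ᶠ t in atTop, γ t ∉ surface a l) ∧
      (aMax = ⊤ → LMax = ⊤ → Tendsto γ atTop (cocompact (ℝ × ℝ × ℝ))) := by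
  have hτm : ∀ {a b : ℝ≥0}, a < b → tau n a < tau n b := fun {a b} hab =>
    strictMonoOn_tau n a.coe_nonneg b.coe_nonneg (by exact_mod_cast hab)
  have hτc : Continuous fun a : ℝ≥0 => tau n a := (continuous_tau n).comp continuous_coe
  have hτmono : StrictMono fun a : ℝ≥0 => tau n a := fun a b hab => hτm hab
  -- The admissible initial slopes, with 0 added for the branch point. Monotonicity of `tau n` makes
  -- J an initial segment even when the length bound is the active one.
  set J : Set ℝ≥0 := {a | ((a : ℝ) : EReal) < aMax ∧ (tau n a : EReal) < LMax} with hJ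
  have hJo : IsOpen J :=
    (isOpen_lt (continuous_coe_real_ereal.comp continuous_coe) continuous_const).inter
      (isOpen_lt (continuous_coe_real_ereal.comp hτc) continuous_const)
  have hJl : IsLowerSet J := fun a b hba ha =>
    ⟨lt_of_le_of_lt (by exact_mod_cast hba) ha.1,
      lt_of_le_of_lt (EReal.coe_le_coe_iff.2 (hτmono.monotone hba)) ha.2⟩
  have h0 : (0 : ℝ≥0) ∈ J := ⟨by simpa using haMax, by simpa using hlt⟩
  obtain ⟨φ, hφm, hφc, hφ0, hφr⟩ := exists_parametrization hJo hJl h0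
  have hφJ : ∀ t, φ t ∈ J := fun t => hφr ▸ mem_range_self t
  have hev : ∀ b ∈ J, ∀ᶠ t in atTop, b < φ t := by
    intro b hb
    rw [← hφr] at hb
    obtain ⟨t₀, rfl⟩ := hb
    filter_upwards [eventually_gt_atTop t₀] with t ht using hφm ht
  have hφpos : ∀ t, 0 < t → (0 : ℝ) < φ t := fun t ht => by
    have := hφm ht
    rw [hφ0] at this
    exact_mod_cast this
  let γ : ℝ≥0 → ℝ × ℝ × ℝ := fun t => point (φ t) (tau n (φ t))
  have hγc : Continuous γ := continuous_point.comp (f := fun t => (((φ t : ℝ≥0) : ℝ), tau n (φ t)))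
    ((continuous_coe.comp hφc).prodMk (hτc.comp hφc))
  have hfstm : StrictMono fun t => tau n (φ t) := hτmono.comp hφm
  -- The first coordinate alone is strictly increasing and continuous, hence an embedding, and this
  -- passes to the curve.
  have hfst : IsEmbedding fun t => tau n (φ t) :=
    hfstm.isEmbedding_of_ordConnected (isPreconnected_range (hτc.comp hφc)).ordConnected
  refine ⟨γ, IsEmbedding.of_comp hγc continuous_fst hfst, ?_, ?_, ?_, ?_, ?_⟩
  · simp [γ, point, hφ0]
  · ext p
    rw [mem_zeroRadiusLocus_iff hμ hg hL]
    constructor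
    · rintro ⟨t, ht, rfl⟩
      exact ⟨φ t, hφpos t ht, (hφJ t).1, (hφJ t).2, rfl⟩
    · rintro ⟨a, ha, haM, hsM, rfl⟩
      have hmem : (⟨a, ha.le⟩ : ℝ≥0) ∈ J := ⟨haM, hsM⟩
      rw [← hφr] at hmem
      obtain ⟨t, ht⟩ := hmem
      refine ⟨t, ?_, by simp only [γ, ht]; rfl⟩
      rw [mem_Ioi, ← hφm.lt_iff_lt, hφ0, ht]
      exact ha
  · intro t ht h
    have hpos := hφpos t ht
    simp only [γ, point, Prod.mk.injEq, mul_eq_zero, hpos.ne', false_or] at h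
    have := sq_add_sq_pos (φ t) (tau n (φ t))
    rw [h.1, h.2] at this
    simp at this
  · intro a l ha hl
    -- The surface point determines its initial slope, so membership in a smaller surface bounds
    -- both parameters. The curve leaves through the slope bound if a is in J, and otherwise through
    -- the length bound, where tau n c = l for some c in J unless l ≤ tau n 0.
    have hkey : ∀ t, γ t ∈ surface a l → (φ t : ℝ) < a ∧ tau n (φ t) < l := by
      intro t ht
      obtain ⟨b, s, -, hba, hs, hsl, heq⟩ := mem_surface_iff.1 ht
      have hsτ : tau n (φ t) = s := congrArg Prod.fst heq
      simp only [γ] at heq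
      rw [hsτ] at heq ⊢
      rw [point_injective hs heq]
      exact ⟨by exact_mod_cast hba, by exact_mod_cast hsl⟩
    rcases le_or_gt a 0 with ha0 | ha0
    · refine Eventually.of_forall fun t ht => ?_
      exact absurd ((hkey t ht).1.trans_le ha0) (not_lt.2 (φ t).coe_nonneg)
    lift a to ℝ≥0 using ha0.le
    by_cases haJ : a ∈ J
    · filter_upwards [hev a haJ] with t ht hmem
      exact absurd ht (not_lt.2 (le_of_lt (by exact_mod_cast (hkey t hmem).1)))
    · have hLa : LMax ≤ (tau n a : EReal) := by
        by_contra! h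
        exact haJ ⟨ha, h⟩
      have hla : l < tau n a := by exact_mod_cast hl.trans_le hLa
      rcases le_or_gt l (tau n 0) with hl0 | hl0
      · refine Eventually.of_forall fun t ht => ?_
        have h1 : tau n ((0 : ℝ≥0) : ℝ) ≤ tau n (φ t) := hτmono.monotone zero_le
        exact absurd (hkey t ht).2 (not_lt.2 (hl0.trans (by simpa using h1)))
      · obtain ⟨c, hc, hcl⟩ := intermediate_value_Icc (a := (0 : ℝ≥0)) (b := a) zero_le hτc.continuousOn
          (show l ∈ Icc (tau n ((0 : ℝ≥0) : ℝ)) (tau n a) from ⟨by simpa using hl0.le, hla.le⟩)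
        simp only at hcl
        have hcJ : c ∈ J := ⟨lt_of_le_of_lt (by exact_mod_cast hc.2) ha, by rw [hcl]; exact hl⟩
        filter_upwards [hev c hcJ] with t ht hmem
        have := hτm ht
        rw [hcl] at this
        exact absurd (hkey t hmem).2 (not_lt.2 this.le)
  · intro haT hLT
    have hφtop : Tendsto φ atTop atTop := tendsto_atTop.2 fun b =>
      (hev b ⟨by rw [haT]; exact EReal.coe_lt_top _, by rw [hLT]; exact EReal.coe_lt_top _⟩).mono
        fun _ h => h.le
    rw [← Metric.cobounded_eq_cocompact, ← tendsto_norm_atTop_iff_cobounded]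
    refine tendsto_atTop_mono (fun t => ?_) (tendsto_coe_atTop.2 hφtop)
    calc (φ t : ℝ) ≤ tau n (φ t) := le_tau _ n
      _ ≤ ‖(γ t).1‖ := le_abs_self _
      _ ≤ ‖γ t‖ := norm_fst_le _

end RotatingChain

open RotatingChain in
theorem mainTheorem4 (μ g L : ℝ) (hμ : 0 < μ) (hg : 0 < g) (hL : 0 < L)
    (aMax LMax : EReal) (haMax : 0 < aMax) (hLMax : 0 < LMax) (i : ℕ) (hi : 1 ≤ i) :
    ∃ h : ℝ, IsNthZero besselJ0 i h ∧
      -- (i) the locus is a curve branching out from the first axis and, without bounds, infinite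
      ((dimlessLength g L (discreteSpeed g L h) : EReal) < LMax →
        ∃ γ : NNReal → ℝ × ℝ × ℝ, Topology.IsEmbedding γ ∧
          γ 0 = (dimlessLength g L (discreteSpeed g L h), 0, 0) ∧
          γ '' Set.Ioi 0 = zeroRadiusLocus μ g L aMax LMax i ∧
          (∀ t, 0 < t → (γ t).2 ≠ (0, 0)) ∧
          (∀ a l : ℝ, (a : EReal) < aMax → (l : EReal) < LMax →
            ∀ᶠ t in Filter.atTop, γ t ∉ surface a l) ∧
          (aMax = ⊤ → LMax = ⊤ →
            Filter.Tendsto γ Filter.atTop (Filter.cocompact (ℝ × ℝ × ℝ)))) ∧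
      -- (ii) the locus separates mode `i - 1` from mode `i`
      (∀ T : Set (ℝ × ℝ × ℝ), T ⊆ surface aMax LMax → IsPreconnected T →
        (T ∩ rotationMode μ g L aMax LMax (i - 1)).Nonempty →
        (T ∩ rotationMode μ g L aMax LMax i).Nonempty →
        (T ∩ zeroRadiusLocus μ g L aMax LMax i).Nonempty) := by
  obtain ⟨n, rfl⟩ : ∃ n, i = n + 1 := ⟨i - 1, by omega⟩
  -- The substitution s = x²/4 makes 2√(tau n 0) the required zero of J₀, and the dimensionless
  -- length of the corresponding speed is tau n 0 again.
  refine ⟨2 * √(tau n 0), isNthZero_besselJ0 n, ?_, fun T hT hconn h₁ h₂ =>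
    locus_separates hμ hg hL hT hconn h₁ h₂⟩
  rw [dimlessLength_discreteSpeed hg hL (tau_pos n 0).le]
  exact exists_locus_curve hμ hg hL haMax
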